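/- **Conventions.** All digraphs are finite. A digraph is connected if its underlying undirected graph is; a cut-vertex is a vertex whose removal disconnects it; a block is a maximal connected subgraph without cut-vertex. For $n,r,m_1,\dots,m_r\ge 1$, $dC(n;m_1,\dots,m_r)$ is the digraph with vertices $u_0,\dots,u_n$ and $v^{(j)}_i$ ($1\le j\le r$, $1\le i\le m_j$), formed by the directed paths $u_0\to u_1\to\cdots\to u_n$ and $u_n=v^{(j)}_0\to v^{(j)}_1\to\cdots\to v^{(j)}_{m_j}\to v^{(j)}_{m_j+1}=u_0$, $1\le j\le r$. A digraph is of cactoid type if it is non-empty, strongly connected, and each of its blocks is isomorphic to some $dC(n;m_1,\dots,m_r)$. For a digraph $G=(V,E)$ with weights $W:E\to\mathbb R$, the entry $d_{xy}$ of the distance matrix is the minimum total weight of a directed path (without repeated vertices) from $x$ to $y$; in particular $d_{xx}=0$. $\operatorname{cof}A$ is the sum of all cofactors of $A$, $\mathbf 1$ is the all-ones column vector, and a square matrix $\mathcal L$ is Laplacian-like if $\mathcal L\mathbf 1=0$ and $\mathbf 1^T\mathcal L=0$. **Block data.** Let a weighted digraph be identified with $dC(n;m_1,\dots,m_r)$.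 Let $W_i$ be the weight of $u_{i-1}\to u_i$ ($1\le i\le n$), $W^{(j)}_i$ the weight of $v^{(j)}_{i-1}\to v^{(j)}_i$ ($1\le i\le m_j$), and $W^{(j)}_0$ the weight of $v^{(j)}_{m_j}\to u_0$. Put $w_c=\sum_{i=1}^n W_i$, $\widehat w_j=\sum_{i=0}^{m_j}W^{(j)}_i$, $w_j=w_c+\widehat w_j$, $w_c^{(2)}=\sum_{1\le s<t\le n}W_sW_t$, $w_j^{(2)}=\sum_{0\le s<t\le m_j}W^{(j)}_sW^{(j)}_t$, and number the cycles such that $w_1\le\cdots\le w_r$. When all $w_j\neq0$, define $$\lambda=\frac{w_c\widehat w_1}{w_1}+\frac{w_c^{(2)}}{w_1}+\sum_{j=1}^r\frac{w_j^{(2)}}{w_j},$$ $$\alpha(u_0)=\sum_{j=1}^r\frac{W^{(j)}_0}{w_j}-\sum_{j=2}^r\frac{\widehat w_j}{w_j},\quad \alpha(u_i)=\frac{W_i}{w_1}\ (1\le i\le n),\quad \alpha(v^{(j)}_i)=\frac{W^{(j)}_i}{w_j},$$ $$\beta(u_i)=\frac{W_{i+1}}{w_1}\ (0\le i<n),\quad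 \beta(u_n)=\sum_{j=1}^r\frac{W^{(j)}_1}{w_j}-\sum_{j=2}^r\frac{\widehat w_j}{w_j},\quad \beta(v^{(j)}_i)=\frac{W^{(j)}_{i+1}}{w_j}\ (1\le i<m_j),\quad \beta(v^{(j)}_{m_j})=\frac{W^{(j)}_0}{w_j},$$ and $\mathcal L=\Delta-A+\widehat L$. Here $A_{xy}=1/w_1$ if $x\to y$ is an edge of the path $u_0\to\cdots\to u_n$, $A_{xy}=1/w_j$ if $x\to y$ is an edge of the $j$-th path from $u_n$ to $u_0$, and $A_{xy}=0$ otherwise; $\Delta$ is the diagonal matrix of row sums of $A$; and $\widehat L_{u_nu_0}=\sum_{j=2}^r 1/w_j$, $\widehat L_{u_nu_n}=-\sum_{j=2}^r1/w_j$, all other entries of $\widehat L$ being $0$. **Theorem.** Let $G=(V,E)$ be a cactoid-type digraph with blocks $G_t=(V_t,E_t)$, $1\le t\le b$, and let $W:E\to\mathbb R$ be a weight function. Let $D$ and $D_t$ be the distance matrices of the weighted digraphs $G^W$ and $G_t^W$. Suppose that $\det D\ne0$ and that $\det D_t\neq 0$ and $\operatorname{cof}D_t\neq0$ for all $t$. Then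 each block $G_t$ can be identified with some $dC(n;m_1,\dots,m_r)$ with $w_1\le\cdots\le w_r$, and for every choice of such identifications, with block data $\lambda_t,\alpha_t,\beta_t,\mathcal L_t$ as above, we have $\lambda_t=\det D_t/\operatorname{cof}D_t$, and the number $\lambda$, column vectors $\alpha,\beta$ and matrix $\mathcal L$ given by $$\lambda=\sum_{t=1}^b\lambda_t,\quad \alpha(v)=\sum_{t:\,v\in V_t}\alpha_t(v)-(\mathrm{bi}(v)-1),\quad \beta(v)=\sum_{t:\,v\in V_t}\beta_t(v)-(\mathrm{bi}(v)-1),\quad \mathcal L=\sum_{t=1}^b\widehat{\mathcal L}_t,$$ where $\mathrm{bi}(v)$ is the number of blocks containing $v$ and $\widehat{\mathcal L}_t$ is $\mathcal L_t$ extended by zeros to $V\times V$, satisfy: $\mathcal L$ is Laplacian-like, $\lambda\ne0$, and $$D^{-1}=-\mathcal L+\frac1\lambda\,\beta\alpha^T .$$ -/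

import Mathlib

open scoped Matrix

namespace CactoidType

/-! ### Digraphs, blocks -/

/-- A digraph is strongly connected if it has a vertex and every vertex can be reached from every
vertex along directed edges. -/
def StronglyConnected {V : Type*} (G : Digraph V) : Prop :=
  Nonempty V ∧ ∀ x y : V, Relation.ReflTransGen G.Adj x y

/-- The subdigraph of `G` induced on a set of vertices. -/
def induce {V : Type*} (G : Digraph V) (S : Finset V) : Digraph S where
  Adj x y := G.Adj x y

/-- `v` is a cut-vertex if deleting it disconnects the digraph, where connectedness
ignores orientations. -/
def IsCutVertex {V : Type*} (G : Digraph V) (v : V) : Prop :=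
  ¬ (G.toSimpleGraphInclusive.induce {v}ᶜ).Preconnected

/-- A block is a maximal connected subgraph without cut-vertex. Such a maximal subgraph contains
all the edges of `G` between its vertices, so a block is given by its set of vertices. -/
def IsBlock {V : Type*} (G : Digraph V) (S : Finset V) : Prop :=
  Maximal (fun T : Finset V =>
    (induce G T).toSimpleGraphInclusive.Connected ∧ ∀ v, ¬ IsCutVertex (induce G T) v) S

/-- The type of (vertex sets of) blocks of `G`. -/
abbrev Block {V : Type*} (G : Digraph V) : Type _ := {S : Finset V // IsBlock G S}

noncomputable instance instFintypeBlock {V : Type*} [Fintype V] (G : Digraph V) :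
    Fintype (Block G) := Fintype.ofFinite _

/-- The number of blocks that contain the vertex `v`. -/
noncomputable def blockIndex {V : Type*} (G : Digraph V) (v : V) : ℕ :=
  Nat.card {t : Block G // v ∈ t.1}

/-! ### Distance matrix of a weighted digraph -/

/-- Total weight of the edges of the directed path listed as `x₀, x₁, …, x_k`. -/
def pathWeight {V : Type*} (W : V → V → ℝ) : List V → ℝ
  | x :: y :: l => W x y + pathWeight W (y :: l)
  | _ => 0

/-- `l` lists the vertices of a directed path (no repeated vertices) from `x` to `y`. -/
def IsDirectedPath {V : Type*} (G : Digraph V) (x y : V) (l : List V) : Prop :=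
  l.IsChain G.Adj ∧ l.Nodup ∧ l.head? = some x ∧ l.getLast? = some y

/-- The distance matrix of `(G, W)`: the `(x, y)` entry is the minimum total weight of a
directed path from `x` to `y`. The value `W x y` is the weight of the edge `x → y`; it is never
used if this is not an edge. -/
noncomputable def distMatrix {V : Type*} (G : Digraph V) (W : V → V → ℝ) : Matrix V V ℝ :=
  Matrix.of fun x y => sInf {c : ℝ | ∃ l, IsDirectedPath G x y l ∧ pathWeight W l = c}

/-- The distance matrix of a block, as a weighted digraph on its own. -/
noncomputable def blockDistMatrix {V : Type*} (G : Digraph V) (W : V → V → ℝ) (t : Block G) :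
    Matrix t.1 t.1 ℝ :=
  distMatrix (induce G t.1) fun x y => W x y

/-- The sum of all cofactors of `A` (the entries of the adjugate are the cofactors, transposed). -/
def cof {ι : Type*} [Fintype ι] [DecidableEq ι] (A : Matrix ι ι ℝ) : ℝ :=
  ∑ i, ∑ j, A.adjugate i j

/-! ### The digraph `dC(n; m₁, …, m_r)` -/

/-- Vertices: `inl i` is the vertex `u_i` of the common path, `0 ≤ i ≤ n`, and
`inr ⟨j, i⟩` is the vertex `v_{i+1}` of the `j`-th remaining path, `1 ≤ i + 1 ≤ m_j`. -/
abbrev DCVert (n : ℕ) {r : ℕ} (m : Fin r → ℕ) : Type := Fin (n + 1) ⊕ (Σ j : Fin r, Fin (m j))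

/-- The digraph consisting of `u_0 → u_1 → ⋯ → u_n` and, for every `j`,
`u_n → v_1^{(j)} → ⋯ → v_{m_j}^{(j)} → u_0` (intended for `n, r, m_j ≥ 1`). -/
def dC (n : ℕ) {r : ℕ} (m : Fin r → ℕ) : Digraph (DCVert n m) where
  Adj x y := match x, y with
    | .inl p, .inl q => q.val = p.val + 1
    | .inl p, .inr ⟨_, i⟩ => p.val = n ∧ i.val = 0
    | .inr ⟨j, i⟩, .inr ⟨l, k⟩ => j = l ∧ k.val = i.val + 1
    | .inr ⟨j, i⟩, .inl q => i.val + 1 = m j ∧ q.val = 0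

/-- An identification of a digraph `G` with some `dC(n; m₁, …, m_r)`, `n, r, m_j ≥ 1`. -/
structure DCPresentation {U : Type*} (G : Digraph U) where
  n : ℕ
  r : ℕ
  m : Fin r → ℕ
  one_le_n : 1 ≤ n
  one_le_r : 1 ≤ r
  one_le_m : ∀ j, 1 ≤ m j
  iso : (dC n m).Adj ≃r G.Adj

/-- Cactoid-type digraphs: strongly connected, and every block is some `dC(n; m₁, …, m_r)`. -/
def IsCactoidType {V : Type*} (G : Digraph V) : Prop :=
  StronglyConnected G ∧ ∀ t : Block G, Nonempty (DCPresentation (induce G t.1))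

/-! ### Laplacian-like matrices and the data `λ, α, β, 𝓛` -/

/-- All row sums and all column sums are zero. -/
def IsLaplacianLike {ι : Type*} [Fintype ι] (L : Matrix ι ι ℝ) : Prop :=
  L *ᵥ 1 = 0 ∧ 1 ᵥ* L = 0

/-- A number `λ`, two column vectors `α, β` and a square matrix `𝓛`. -/
structure LapData (ι : Type*) where
  lam : ℝ
  α : ι → ℝ
  β : ι → ℝ
  L : Matrix ι ι ℝ

/-- The sum of `f s * f t` over all `s < t`. -/
def pairSum {k : ℕ} (f : Fin k → ℝ) : ℝ :=
  ∑ p : Fin k × Fin k with p.1 < p.2, f p.1 * f p.2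

namespace DC

variable {n r : ℕ} {m : Fin r → ℕ} (W : DCVert n m → DCVert n m → ℝ)

/-- Weight of the edge `u_i → u_{i+1}`, `0 ≤ i < n`. -/
def commonWeight (i : Fin n) : ℝ := W (.inl i.castSucc) (.inl i.succ)

/-- The vertices `u_n = v_0, v_1, …, v_{m_j}, v_{m_j + 1} = u_0` of the `j`-th path. -/
def pathVertex (j : Fin r) : Fin (m j + 2) → DCVert n m :=
  Fin.cases (.inl (Fin.last n)) (Fin.lastCases (.inl 0) fun i => .inr ⟨j, i⟩)

/-- Weight of the edge `v_i → v_{i+1}`, `0 ≤ i ≤ m_j`, of the `j`-th path. -/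
def ownWeight (j : Fin r) (i : Fin (m j + 1)) : ℝ :=
  W (pathVertex j i.castSucc) (pathVertex j i.succ)

/-- Total weight of the common path. -/
def wc : ℝ := ∑ i, commonWeight W i

/-- Total weight of the `j`-th path from `u_n` to `u_0`. -/
def wHat (j : Fin r) : ℝ := ∑ i, ownWeight W j i

/-- Total weight of the `j`-th cycle. -/
def w (j : Fin r) : ℝ := wc W + wHat W j

variable (j₁ : Fin r)

/-- The number `λ`; here and below `j₁` stands for the first index. -/
noncomputable def lam : ℝ :=
  wc W * wHat W j₁ / w W j₁ + pairSum (commonWeight W) / w W j₁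
    + ∑ j, pairSum (ownWeight W j) / w W j

/-- The vector `α`. -/
noncomputable def alpha : DCVert n m → ℝ
  | .inl i => Fin.cases (motive := fun _ => ℝ)
      (∑ j, ownWeight W j (Fin.last (m j)) / w W j
        - ∑ j ∈ Finset.univ.erase j₁, wHat W j / w W j)
      (fun i => commonWeight W i / w W j₁) i
  | .inr ⟨j, i⟩ => ownWeight W j i.castSucc / w W j

/-- The vector `β`. -/
noncomputable def beta : DCVert n m → ℝ
  | .inl i => Fin.lastCases (motive := fun _ => ℝ)
      (∑ j, ownWeight W j 0 / w W j - ∑ j ∈ Finset.univ.erase j₁, wHat W j / w W j)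
      (fun i => commonWeight W i / w W j₁) i
  | .inr ⟨j, i⟩ => ownWeight W j i.succ / w W j

open Classical in
/-- The adjacency matrix in which the edges of the common path have weight `1 / w_1`
and the edges of the `j`-th path have weight `1 / w_j`. -/
noncomputable def adj : Matrix (DCVert n m) (DCVert n m) ℝ := Matrix.of fun x y =>
  if (dC n m).Adj x y then
    match x, y with
    | .inl _, .inl _ => 1 / w W j₁
    | .inl _, .inr ⟨j, _⟩ => 1 / w W j
    | .inr ⟨j, _⟩, _ => 1 / w W j
  else 0

/-- The perturbation of the Laplacian matrix. -/
noncomputable def perturbation : Matrix (DCVert n m) (DCVert n m) ℝ := Matrix.of fun x y =>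
  if x = .inl (Fin.last n) ∧ y = .inl 0 then ∑ j ∈ Finset.univ.erase j₁, 1 / w W j
  else if x = .inl (Fin.last n) ∧ y = .inl (Fin.last n) then
    -∑ j ∈ Finset.univ.erase j₁, 1 / w W j
  else 0

/-- The matrix `𝓛`: out-degrees minus adjacency matrix plus perturbation. -/
noncomputable def lap : Matrix (DCVert n m) (DCVert n m) ℝ :=
  Matrix.diagonal (fun x => ∑ y, adj W j₁ x y) - adj W j₁ + perturbation W j₁

end DC

namespace DCPresentation

variable {U : Type*} {G : Digraph U} (P : DCPresentation G) (W : U → U → ℝ)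

/-- The weights of `G` read on `dC(n; m₁, …, m_r)`. -/
def weight : DCVert P.n P.m → DCVert P.n P.m → ℝ := fun x y => W (P.iso x) (P.iso y)

/-- The cycles are numbered such that `w_1 ≤ w_2 ≤ ⋯ ≤ w_r`. -/
def IsOrdered : Prop := Monotone (DC.w (P.weight W))

/-- The first index. -/
def first : Fin P.r := ⟨0, P.one_le_r⟩

/-- The data `λ, α, β, 𝓛` of `dC(n; m₁, …, m_r)`, read on the vertices of `G`. -/
noncomputable def lapData : LapData U where
  lam := DC.lam (P.weight W) P.first
  α u := DC.alpha (P.weight W) P.first (P.iso.symm u)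
  β u := DC.beta (P.weight W) P.first (P.iso.symm u)
  L := Matrix.of fun u v => DC.lap (P.weight W) P.first (P.iso.symm u) (P.iso.symm v)

end DCPresentation

open Classical in
/-- The composition of data `λ_t, α_t, β_t, 𝓛_t` given on the blocks of `G`:
`λ = ∑ λ_t`, `α(v) = ∑ α_t(v) - (bi(v) - 1)`, `β(v) = ∑ β_t(v) - (bi(v) - 1)`, where `t` runs over
the blocks containing `v` and `bi(v)` is their number, and `𝓛` is the sum of the `𝓛_t`, each
extended by zero. -/
noncomputable def composition {V : Type*} [Fintype V] (G : Digraph V)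
    (B : ∀ t : Block G, LapData t.1) : LapData V where
  lam := ∑ t, (B t).lam
  α v := (∑ t : Block G, if h : v ∈ t.1 then (B t).α ⟨v, h⟩ else 0) - ((blockIndex G v : ℝ) - 1)
  β v := (∑ t : Block G, if h : v ∈ t.1 then (B t).β ⟨v, h⟩ else 0) - ((blockIndex G v : ℝ) - 1)
  L := ∑ t : Block G, Matrix.of fun u v =>
    if h : u ∈ t.1 ∧ v ∈ t.1 then (B t).L ⟨u, h.1⟩ ⟨v, h.2⟩ else 0

end CactoidType

/-!
Consider the identities `D β = λ 1`, `D 𝓛 = 1 αᵀ - I`, `1ᵀ β = 1`, `𝓛 1 = 0` and `1ᵀ 𝓛 = 0`. They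
make sense for singular `D` and imply `det D = λ cof D`; if `det D ≠ 0`, they give
`D⁻¹ = -𝓛 + λ⁻¹ β αᵀ`. So it suffices to show that they hold for each block and are inherited by
the whole digraph.

On `dC(n; m₁, …, m_r)` every `x ≠ u_n` has a unique successor `x'`, so that the row of `x` minus the
row of `x'` is the constant `W x x'`, except that the diagonal entry is lower by the weight `w_j` of
the cycle through `x`; dually for the columns of `y ≠ u_0` and of its predecessor. This reduces
`D β = λ 1` to the row of `u_n`, and gives `D 𝓛 = 1 αᵀ - I` because the column `y` of `𝓛` is
`(e_y - e_{y'}) / w_j` with `y'` the predecessor of `y`. If `w_j = 0`, two rows differ by a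
constant, which forces `cof D = 0`.

For the whole digraph, all walks from `x` enter a block `t` through one vertex, the gate `g_t(x)`,
so `D x z = D x g_t(x) + D_t g_t(x) z` for `z` in `t`. Every `y ≠ x` is the gate of all blocks
containing it but one, whence `β = e_x + ∑ t, (β_t - e_{g_t(x)})` and likewise for `α`. Row `x`
of the identities for `D` thus follows by adding up the rows `g_t(x)` of those for the `D_t`.
-/

namespace CactoidType

section Biconnected

open SimpleGraph

variable {V : Type*} {H : SimpleGraph V} {S T : Set V} {p q v x y : V}

theorem exists_walk_of_preconnected_induce (h : (H.induce S).Preconnected) (hx : x ∈ S)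
    (hy : y ∈ S) : ∃ w : H.Walk x y, ∀ z ∈ w.support, z ∈ S := by
  obtain ⟨w⟩ := h ⟨x, hx⟩ ⟨y, hy⟩
  have hsupport := Walk.support_map (Embedding.induce S).toHom w
  refine ⟨w.map (Embedding.induce S).toHom, fun z hz => ?_⟩
  obtain ⟨a, -, rfl⟩ := List.mem_map.1 (hsupport ▸ hz)
  exact a.2

theorem exists_first_entry {s : V} (w : H.Walk x s) (hx : x ∉ S) (hs : s ∈ S) :
    ∃ c p, ∃ u : H.Walk x c, (∀ z ∈ u.support, z ∉ S) ∧ H.Adj c p ∧ p ∈ S ∧ p ∈ w.support := by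
  induction w with
  | nil => exact absurd hs hx
  | @cons a b _ hab w ih =>
    by_cases hb : b ∈ S
    · exact ⟨a, b, .nil, by simpa using hx, hab, hb, by simp⟩
    · obtain ⟨c, p, u, hu, hcp, hp, hpw⟩ := ih hb hs
      exact ⟨c, p, .cons hab u, by simpa [hx] using hu, hcp, hp, by simp [hpw]⟩

theorem exists_walk_to_endpoint_avoiding {w : H.Walk p q} (hw : w.IsPath)
    (hx : x ∈ w.support) (hxv : x ≠ v) : ∃ e, (e = p ∨ e = q) ∧
      ∃ u : H.Walk x e, ∀ z ∈ u.support, z ∈ w.support ∧ z ≠ v := by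
  classical
  by_cases hv : v ∈ (w.takeUntil x hx).support
  · refine ⟨q, .inr rfl, w.dropUntil x hx, fun z hz =>
      ⟨w.support_dropUntil_subset_support hx hz, ?_⟩⟩
    rw [← w.take_spec hx] at hw
    rintro rfl
    exact hw.ne_of_mem_support_of_append hxv.symm hv hz rfl
  · refine ⟨p, .inl rfl, (w.takeUntil x hx).reverse, fun z hz => ?_⟩
    replace hz : z ∈ (w.takeUntil x hx).support := by simpa using hz
    exact ⟨w.support_takeUntil_subset_support hx hz, fun h => hv (h ▸ hz)⟩

/-- A set of vertices is biconnected if its induced subgraph is connected and has no cut-vertex.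
Deleting a vertex `v ∉ S` changes nothing, so `v` may range over all vertices. -/
def IsBiconnected (H : SimpleGraph V) (S : Set V) : Prop :=
  (H.induce S).Connected ∧ ∀ v, (H.induce (S \ {v})).Preconnected

namespace IsBiconnected

theorem exists_walk (h : IsBiconnected H S) (hx : x ∈ S) (hy : y ∈ S) :
    ∃ w : H.Walk x y, ∀ z ∈ w.support, z ∈ S :=
  exists_walk_of_preconnected_induce h.1.preconnected hx hy

theorem nonempty (h : IsBiconnected H S) : S.Nonempty :=
  Set.nonempty_coe_sort.1 h.1.nonempty

theorem pair (h : H.Adj x y) : IsBiconnected H {x, y} := by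
  refine ⟨induce_pair_connected_of_adj h, fun v => ?_⟩
  by_cases hv : v ∈ ({x, y} : Set V)
  · have : (({x, y} : Set V) \ {v}).Subsingleton := by
      rintro a ⟨ha, hav⟩ b ⟨hb, hbv⟩
      grind
    have := this.coe_sort
    exact .of_subsingleton
  · rw [Set.sdiff_singleton_eq_self hv]
    exact (induce_pair_connected_of_adj h).preconnected

theorem union (hS : IsBiconnected H S) (hT : IsBiconnected H T) (hST : (S ∩ T).Nontrivial) :
    IsBiconnected H (S ∪ T) := by
  refine ⟨induce_union_connected hS.1.preconnected hT.1.preconnected hST.nonempty, fun v => ?_⟩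
  obtain ⟨a, ha, hav⟩ := hST.exists_ne v
  rw [Set.union_sdiff_distrib]
  exact (induce_union_connected (hS.2 v) (hT.2 v)
    ⟨a, ⟨ha.1, hav⟩, ha.2, hav⟩).preconnected

theorem union_support (hS : IsBiconnected H S) (hp : p ∈ S) (hq : q ∈ S) {w : H.Walk p q}
    (hw : w.IsPath) : IsBiconnected H (S ∪ {z | z ∈ w.support}) := by
  classical
  refine ⟨induce_union_connected hS.1.preconnected w.connected_induce_support.preconnected
    ⟨p, hp, w.start_mem_support⟩, fun v => ?_⟩
  set A := (S ∪ {z | z ∈ w.support}) \ {v} with hA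
  have to_S : ∀ x ∈ A, ∃ s ∈ S \ {v}, ∃ u : H.Walk x s, ∀ z ∈ u.support, z ∈ A := by
    rintro x ⟨hxS | hxw, hxv⟩
    · exact ⟨x, ⟨hxS, hxv⟩, .nil, by simpa [hA] using ⟨.inl hxS, hxv⟩⟩
    · obtain ⟨e, he, u, hu⟩ := exists_walk_to_endpoint_avoiding hw hxw hxv
      exact ⟨e, ⟨by rcases he with rfl | rfl <;> assumption, (hu e u.end_mem_support).2⟩, u,
        fun z hz => ⟨.inr (hu z hz).1, (hu z hz).2⟩⟩
  rintro ⟨x, hx⟩ ⟨y, hy⟩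
  obtain ⟨s, hs, u, hu⟩ := to_S x hx
  obtain ⟨s', hs', u', hu'⟩ := to_S y hy
  obtain ⟨b, hb⟩ := exists_walk_of_preconnected_induce (hS.2 v) hs hs'
  refine ⟨(u.append (b.append u'.reverse)).induce A fun z hz => ?_⟩
  simp only [Walk.mem_support_append_iff, Walk.support_reverse, List.mem_reverse] at hz
  rcases hz with hz | hz | hz
  exacts [hu z hz, ⟨.inl (hb z hz).1, (hb z hz).2⟩, hu' z hz]

theorem mem_of_mem_support (hS : Maximal (IsBiconnected H) S) (hp : p ∈ S) (hq : q ∈ S)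
    {w : H.Walk p q} (hw : w.IsPath) (hx : x ∈ w.support) : x ∈ S :=
  hS.le_of_ge (hS.prop.union_support hp hq hw) Set.subset_union_left (.inr hx)

theorem eq_of_nontrivial_inter (hS : Maximal (IsBiconnected H) S)
    (hT : Maximal (IsBiconnected H) T) (hST : (S ∩ T).Nontrivial) : S = T :=
  (hS.eq_of_le (hS.prop.union hT.prop hST) Set.subset_union_left).trans
    (hT.eq_of_le (hS.prop.union hT.prop hST) Set.subset_union_right).symm

theorem eq_of_adj_of_walk_compl (hS : Maximal (IsBiconnected H) S) {c d : V} (hp : p ∈ S)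
    (hq : q ∈ S) (hpc : H.Adj p c) (hdq : H.Adj d q) (w : H.Walk c d)
    (hw : ∀ z ∈ w.support, z ∉ S) : p = q := by
  classical
  by_contra hpq
  have hb : ∀ z ∈ w.bypass.support, z ∉ S :=
    fun z hz => hw z (w.support_bypass_subset_support hz)
  have hpath : (Walk.cons hpc (w.bypass.concat hdq)).IsPath := by
    rw [Walk.cons_isPath_iff, Walk.concat_isPath_iff, Walk.support_concat,
      List.mem_append, List.mem_singleton]
    exact ⟨⟨w.bypass_isPath, fun h => hb q h hq⟩, by rintro (h | h); exacts [hb p h hp, hpq h]⟩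
  exact hw c w.start_mem_support (mem_of_mem_support hS hp hq hpath (by simp))

end IsBiconnected

/-- `p` is the gate of `S` seen from `x`: the vertex in which every walk from `x` enters `S`. -/
def IsGate (H : SimpleGraph V) (S : Set V) (x p : V) : Prop :=
  p ∈ S ∧ ∀ s ∈ S, ∀ w : H.Walk x s, p ∈ w.support

theorem IsGate.eq_of_mem (h : IsGate H S x p) (hx : x ∈ S) : p = x := by
  simpa using h.2 x hx .nil

theorem exists_isGate (hH : H.Connected) (hS : Maximal (IsBiconnected H) S) (x : V) :
    ∃ p, IsGate H S x p := by
  by_cases hx : x ∈ S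
  · exact ⟨x, hx, fun s _ w => w.start_mem_support⟩
  obtain ⟨s, hs⟩ := hS.prop.nonempty
  obtain ⟨w⟩ := hH.preconnected x s
  obtain ⟨c, p, u, hu, hcp, hp, -⟩ := exists_first_entry w hx hs
  refine ⟨p, hp, fun s' hs' w' => ?_⟩
  obtain ⟨d, q, u', hu', hdq, hq, hqw⟩ := exists_first_entry w' hx hs'
  have hpq : p = q := IsBiconnected.eq_of_adj_of_walk_compl hS hp hq hcp.symm hdq
    (u.reverse.append u')
    (by simpa [Walk.mem_support_append_iff, or_imp, forall_and] using ⟨hu, hu'⟩)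
  exact hpq ▸ hqw

theorem IsGate.exists_walk_avoiding (hH : H.Connected) (hp : IsGate H S x p) (hy : y ∈ S)
    (hpy : p ≠ y) : ∃ w : H.Walk x p, y ∉ w.support := by
  classical
  obtain ⟨w⟩ := hH.preconnected x p
  refine ⟨w.bypass, fun hyw => ?_⟩
  exact Walk.endpoint_notMem_support_takeUntil w.bypass_isPath hyw hpy (hp.2 y hy _)

theorem IsGate.eq_of_ne (hH : H.Connected) (hS : Maximal (IsBiconnected H) S)
    (hT : Maximal (IsBiconnected H) T) (hyS : y ∈ S) (hyT : y ∈ T) (hp : IsGate H S x p)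
    (hq : IsGate H T x q) (hpy : p ≠ y) (hqy : q ≠ y) : S = T := by
  obtain ⟨g, hg⟩ := exists_isGate hH hS q
  obtain ⟨a, ha⟩ := hp.exists_walk_avoiding hH hyS hpy
  obtain ⟨b, hb⟩ := hq.exists_walk_avoiding hH hyT hqy
  have hgy : g ≠ y := by
    rintro rfl
    simpa [Walk.mem_support_append_iff, ha, hb] using hg.2 p hp.1 (b.reverse.append a)
  obtain ⟨c, hc⟩ := hT.prop.exists_walk hq.1 hyT
  have hgT : g ∈ T := hc g (hg.2 y hyS c)
  exact IsBiconnected.eq_of_nontrivial_inter hS hT ⟨g, ⟨hg.1, hgT⟩, y, ⟨hyS, hyT⟩, hgy⟩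

theorem exists_isGate_ne [Finite V] (hH : H.Connected) (hxy : x ≠ y) :
    ∃ S, Maximal (IsBiconnected H) S ∧ y ∈ S ∧ ∀ p, IsGate H S x p → p ≠ y := by
  obtain ⟨w⟩ := hH.preconnected x y
  obtain ⟨z, y', u, hu, hzy, rfl, -⟩ := exists_first_entry (S := {y}) w hxy rfl
  obtain ⟨S, hle, hS⟩ := Finite.exists_le_maximal (IsBiconnected.pair hzy)
  refine ⟨S, hS, hle (by simp), fun p hp => ?_⟩
  exact hu p (hp.2 z (hle (by simp)) u)

theorem preconnected_induce_compl_singleton_iff (v : S) :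
    ((H.induce S).induce {v}ᶜ).Preconnected ↔ (H.induce (S \ {v.1})).Preconnected := by
  have himage : Subtype.val '' ({v}ᶜ : Set S) = S \ {v.1} := by
    rw [Set.image_compl_eq_range_sdiff_image Subtype.val_injective, Subtype.range_coe,
      Set.image_singleton]
  rw [← himage]
  exact Iso.preconnected_iff
    (⟨Equiv.Set.image _ {v}ᶜ Subtype.val_injective, Iff.rfl⟩ :
      (H.induce S).induce {v}ᶜ ≃g H.induce (Subtype.val '' {v}ᶜ))

end Biconnected

section Blocks

variable {V : Type*} {G : Digraph V}

theorem toSimpleGraphInclusive_induce (G : Digraph V) (S : Finset V) :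
    (induce G S).toSimpleGraphInclusive = G.toSimpleGraphInclusive.induce (S : Set V) := by
  ext x y
  simp only [Digraph.toSimpleGraphInclusive, induce, SimpleGraph.fromRel_adj, ne_eq,
    SimpleGraph.comap_adj, Function.Embedding.subtype_apply, Subtype.ext_iff]

theorem isBiconnected_coe_iff {S : Finset V} :
    IsBiconnected G.toSimpleGraphInclusive S ↔
      (induce G S).toSimpleGraphInclusive.Connected ∧ ∀ v, ¬ IsCutVertex (induce G S) v := by
  simp only [IsBiconnected, IsCutVertex, not_not, toSimpleGraphInclusive_induce]
  refine and_congr_right fun hconn =>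
    ⟨fun h v => (preconnected_induce_compl_singleton_iff _).2 (h v), fun h v => ?_⟩
  by_cases hv : v ∈ S
  · exact (preconnected_induce_compl_singleton_iff _).1 (h ⟨v, hv⟩)
  · rw [Set.sdiff_singleton_eq_self (by simpa using hv)]
    exact hconn.preconnected

theorem isBlock_iff [Finite V] {S : Finset V} :
    IsBlock G S ↔ Maximal (IsBiconnected G.toSimpleGraphInclusive) (S : Set V) := by
  simp only [IsBlock, ← isBiconnected_coe_iff]
  refine ⟨fun h => ⟨h.prop, fun T hT hST => ?_⟩, fun h => ⟨h.prop, fun T hT hST => ?_⟩⟩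
  · obtain ⟨T, rfl⟩ := T.toFinite.exists_finset_coe
    exact Finset.coe_subset.2 (h.2 hT (Finset.coe_subset.1 hST))
  · exact Finset.coe_subset.1 (h.2 hT (Finset.coe_subset.2 hST))

end Blocks

section DirectedPath

variable {V : Type*} {G : Digraph V} {W : V → V → ℝ} {x y p : V} {l l₁ l₂ : List V}

theorem pathWeight_append (W : V → V → ℝ) (l₁ : List V) (p : V) (l₂ : List V) :
    pathWeight W (l₁ ++ p :: l₂) = pathWeight W (l₁ ++ [p]) + pathWeight W (p :: l₂) := by
  induction l₁ with
  | nil => simp [pathWeight]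
  | cons a l₁ ih =>
    cases l₁ with
    | nil => simp [pathWeight]
    | cons b l₁ =>
      simp only [List.cons_append, pathWeight] at ih ⊢
      rw [ih, add_assoc]

theorem pathWeight_map {U : Type*} (f : U → V) (W : V → V → ℝ) (l : List U) :
    pathWeight W (l.map f) = pathWeight (fun a b => W (f a) (f b)) l := by
  induction l with
  | nil => rfl
  | cons a l ih =>
    cases l with
    | nil => rfl
    | cons b l => simpa [pathWeight] using ih

theorem pathWeight_reverse (W : V → V → ℝ) (l : List V) :
    pathWeight W l.reverse = pathWeight (fun x y => W y x) l := by
  induction l with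
  | nil => rfl
  | cons a l ih =>
    cases l with
    | nil => rfl
    | cons b l =>
      rw [List.reverse_cons] at ih
      rw [List.reverse_cons, List.reverse_cons, List.append_assoc, List.singleton_append,
        pathWeight_append, ih]
      simp [pathWeight, add_comm]

theorem pathWeight_ofFn (W : V → V → ℝ) {N : ℕ} (f : Fin (N + 1) → V) :
    pathWeight W (List.ofFn f) = ∑ i : Fin N, W (f i.castSucc) (f i.succ) := by
  induction N with
  | zero => simp [pathWeight]
  | succ N ih =>
    have ih := ih fun i => f i.succ
    rw [List.ofFn_succ] at ih
    rw [List.ofFn_succ, List.ofFn_succ, pathWeight, ih, Fin.sum_univ_succ]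
    rfl

theorem isDirectedPath_append_iff : IsDirectedPath G x y (l₁ ++ p :: l₂) ↔
    IsDirectedPath G x p (l₁ ++ [p]) ∧ IsDirectedPath G p y (p :: l₂) ∧
      ∀ a ∈ l₁, a ∉ p :: l₂ := by
  unfold IsDirectedPath
  rw [List.isChain_split]
  simp only [List.nodup_append, List.head?_append,
    List.getLast?_append, List.head?_cons, List.getLast?_cons, List.mem_singleton,
    List.nodup_singleton, Option.or_some, Option.some_or, Option.some.injEq]
  grind

theorem isDirectedPath_cons_cons_iff {a b : V} : IsDirectedPath G x y (a :: b :: l) ↔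
    a = x ∧ G.Adj a b ∧ a ∉ b :: l ∧ IsDirectedPath G b y (b :: l) := by
  simp only [IsDirectedPath, List.isChain_cons_cons, List.nodup_cons, List.head?_cons,
    List.getLast?_cons_cons, Option.some.injEq]
  tauto

theorem isDirectedPath_singleton_iff {a : V} :
    IsDirectedPath G x y [a] ↔ a = x ∧ a = y := by
  simp [IsDirectedPath]

theorem IsDirectedPath.exists_eq_cons (h : IsDirectedPath G x y l) : ∃ l', l = x :: l' :=
  List.head?_eq_some_iff.1 h.2.2.1

theorem IsDirectedPath.exists_eq_append (h : IsDirectedPath G x y l) : ∃ l', l = l' ++ [y] :=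
  List.getLast?_eq_some_iff.1 h.2.2.2

theorem IsDirectedPath.exists_eq_cons_cons (h : IsDirectedPath G x y l) (hxy : x ≠ y) :
    ∃ a l', l = x :: a :: l' := by
  obtain ⟨_ | ⟨a, l'⟩, rfl⟩ := h.exists_eq_cons
  · exact absurd (isDirectedPath_singleton_iff.1 h).2 hxy
  · exact ⟨a, l', rfl⟩

theorem isDirectedPath_self_iff : IsDirectedPath G x x l ↔ l = [x] := by
  constructor
  · intro h
    obtain ⟨_ | ⟨a, l'⟩, rfl⟩ := h.exists_eq_cons
    · rfl
    · have hnodup := h.2.1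
      exact absurd (List.mem_of_getLast? ((List.getLast?_cons_cons).symm.trans h.2.2.2))
        (List.nodup_cons.1 hnodup).1
  · rintro rfl
    exact isDirectedPath_singleton_iff.2 ⟨rfl, rfl⟩

theorem exists_isDirectedPath (h : Relation.ReflTransGen G.Adj x y) :
    ∃ l, IsDirectedPath G x y l := by
  induction h using Relation.ReflTransGen.head_induction_on with
  | refl => exact ⟨[y], isDirectedPath_self_iff.2 rfl⟩
  | @head a c hac _ ih =>
    obtain ⟨l, hl⟩ := ih
    by_cases ha : a ∈ l
    · obtain ⟨l₁, l₂, rfl⟩ := List.append_of_mem ha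
      exact ⟨_, (isDirectedPath_append_iff.1 hl).2.1⟩
    · obtain ⟨l', rfl⟩ := hl.exists_eq_cons
      exact ⟨a :: c :: l', isDirectedPath_cons_cons_iff.2 ⟨rfl, hac, ha, hl⟩⟩

theorem isDirectedPath_map_iff {U : Type*} {G' : Digraph U} {f : U → V}
    (hf : Function.Injective f) (hG : ∀ a b, G'.Adj a b ↔ G.Adj (f a) (f b)) {a b : U}
    {l : List U} : IsDirectedPath G (f a) (f b) (l.map f) ↔ IsDirectedPath G' a b l := by
  simp only [IsDirectedPath, List.isChain_map, List.nodup_map_iff hf, List.head?_map,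
    List.getLast?_map, ← hG, Option.map_eq_some_iff, hf.eq_iff, exists_eq_right]

theorem isDirectedPath_ofFn {N : ℕ} {f : Fin (N + 1) → V} (hf : Function.Injective f)
    (hadj : ∀ i : Fin N, G.Adj (f i.castSucc) (f i.succ)) :
    IsDirectedPath G (f 0) (f (Fin.last N)) (List.ofFn f) := by
  refine ⟨List.isChain_ofFn.2 fun i hi => hadj ⟨i, by omega⟩, List.nodup_ofFn.2 hf, ?_, ?_⟩
  · rw [List.ofFn_succ, List.head?_cons]
  · rw [List.ofFn_succ', List.concat_eq_append, List.getLast?_concat]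

/-- The digraph with all edges reversed; it turns statements about out-neighbours into statements
about in-neighbours. -/
def reverse (G : Digraph V) : Digraph V where
  Adj x y := G.Adj y x

theorem isDirectedPath_reverse_iff :
    IsDirectedPath (reverse G) x y l ↔ IsDirectedPath G y x l.reverse := by
  simp only [IsDirectedPath, reverse, List.isChain_reverse, List.nodup_reverse, List.head?_reverse,
    List.getLast?_reverse]
  tauto

theorem notMem_of_unique_out {x' : V} (hout : ∀ a, G.Adj x a → a = x') (hxx' : x ≠ x')
    (hxy : x ≠ y) (h : IsDirectedPath G x' y l) : x ∉ l := by
  intro hmem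
  obtain ⟨l₁, l₂, rfl⟩ := List.append_of_mem hmem
  obtain ⟨h₁, h₂, hdisj⟩ := isDirectedPath_append_iff.1 h
  obtain ⟨a, l₂', hl₂⟩ := h₂.exists_eq_cons_cons hxy
  obtain ⟨b, l₁', hl₁⟩ := h₁.exists_eq_cons_cons hxx'.symm
  rw [hl₂] at h₂
  obtain rfl := hout a (isDirectedPath_cons_cons_iff.1 h₂).2.1
  have ha : a ∈ l₁ := by cases l₁ <;> simp_all
  exact hdisj a ha (by simp [hl₂])

theorem IsDirectedPath.exists_walk (h : IsDirectedPath G x y l) :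
    ∃ w : G.toSimpleGraphInclusive.Walk x y, w.IsPath ∧ w.support = l := by
  suffices hw : ∃ w : G.toSimpleGraphInclusive.Walk x y, w.support = l by
    obtain ⟨w, hw⟩ := hw
    exact ⟨w, (SimpleGraph.Walk.isPath_def w).2 (hw ▸ h.2.1), hw⟩
  induction l generalizing x with
  | nil => simp [IsDirectedPath] at h
  | cons a l ih =>
    cases l with
    | nil =>
      obtain ⟨rfl, rfl⟩ := isDirectedPath_singleton_iff.1 h
      exact ⟨.nil, rfl⟩
    | cons b l =>
      obtain ⟨rfl, hab, hnotMem, h'⟩ := isDirectedPath_cons_cons_iff.1 h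
      obtain ⟨w, hw⟩ := ih h'
      have hab' : G.toSimpleGraphInclusive.Adj a b :=
        (SimpleGraph.fromRel_adj ..).2 ⟨fun h => hnotMem (by simp [h]), .inl hab⟩
      exact ⟨.cons hab' w, by simp [hw]⟩

theorem connected_of_exists_isDirectedPath [Nonempty V]
    (hG : ∀ x y, ∃ l, IsDirectedPath G x y l) : G.toSimpleGraphInclusive.Connected := by
  refine ⟨fun x y => ?_⟩
  obtain ⟨l, hl⟩ := hG x y
  obtain ⟨w, -⟩ := hl.exists_walk
  exact ⟨w⟩

end DirectedPath

section Distance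

variable {V : Type*} {G : Digraph V} {W : V → V → ℝ} {x y z p : V} {l : List V}

theorem finite_pathWeights [Finite V] (G : Digraph V) (W : V → V → ℝ) (x y : V) :
    {c : ℝ | ∃ l, IsDirectedPath G x y l ∧ pathWeight W l = c}.Finite := by
  classical
  have := Fintype.ofFinite V
  refine (Set.finite_range fun l : {l : List V // l.Nodup} => pathWeight W l.1).subset ?_
  rintro _ ⟨l, hl, rfl⟩
  exact ⟨⟨l, hl.2.1⟩, rfl⟩

theorem distMatrix_le [Finite V] (h : IsDirectedPath G x y l) :
    distMatrix G W x y ≤ pathWeight W l :=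
  csInf_le (finite_pathWeights G W x y).bddBelow ⟨l, h, rfl⟩

theorem exists_pathWeight_eq_distMatrix [Finite V] (W : V → V → ℝ)
    (h : ∃ l, IsDirectedPath G x y l) :
    ∃ l, IsDirectedPath G x y l ∧ pathWeight W l = distMatrix G W x y := by
  obtain ⟨l, hl⟩ := h
  have hne : {c : ℝ | ∃ l, IsDirectedPath G x y l ∧ pathWeight W l = c}.Nonempty :=
    ⟨_, l, hl, rfl⟩
  exact hne.csInf_mem (finite_pathWeights G W x y)

theorem distMatrix_self (G : Digraph V) (W : V → V → ℝ) (x : V) : distMatrix G W x x = 0 := by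
  simp [distMatrix, isDirectedPath_self_iff, pathWeight]

theorem distMatrix_reverse (G : Digraph V) (W : V → V → ℝ) :
    distMatrix (reverse G) (fun x y => W y x) = (distMatrix G W)ᵀ := by
  ext x y
  refine congrArg sInf (Set.ext fun c => ⟨?_, ?_⟩)
  · rintro ⟨l, hl, rfl⟩
    exact ⟨l.reverse, isDirectedPath_reverse_iff.1 hl, pathWeight_reverse W l⟩
  · rintro ⟨l, hl, rfl⟩
    refine ⟨l.reverse, isDirectedPath_reverse_iff.2 (l.reverse_reverse.symm ▸ hl), ?_⟩
    rw [← pathWeight_reverse, l.reverse_reverse]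

theorem distMatrix_map {U : Type*} {G' : Digraph U} {f : U → V}
    (hf : Function.Injective f) (hG : ∀ a b, G'.Adj a b ↔ G.Adj (f a) (f b)) {a b : U}
    (hl : ∀ l, IsDirectedPath G (f a) (f b) l → ∀ c ∈ l, c ∈ Set.range f) :
    distMatrix G W (f a) (f b) = distMatrix G' (fun a b => W (f a) (f b)) a b := by
  refine congrArg sInf (Set.ext fun c => ⟨?_, ?_⟩)
  · rintro ⟨l, h, rfl⟩
    obtain ⟨l, rfl⟩ : l ∈ Set.range (List.map f) := by
      rw [Set.range_list_map]
      exact hl l h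
    exact ⟨l, (isDirectedPath_map_iff hf hG).1 h, (pathWeight_map ..).symm⟩
  · rintro ⟨l, h, rfl⟩
    exact ⟨l.map f, (isDirectedPath_map_iff hf hG).2 h, pathWeight_map ..⟩

theorem le_distMatrix_of_forall_adj [Finite V] {c : ℝ} (hG : ∃ l, IsDirectedPath G x y l)
    (hxy : x ≠ y) (hc : ∀ a, G.Adj x a → c ≤ W x a + distMatrix G W a y) :
    c ≤ distMatrix G W x y := by
  obtain ⟨l, hl, hW⟩ := exists_pathWeight_eq_distMatrix W hG
  obtain ⟨a, l', rfl⟩ := hl.exists_eq_cons_cons hxy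
  obtain ⟨-, hxa, -, hl'⟩ := isDirectedPath_cons_cons_iff.1 hl
  rw [← hW, pathWeight]
  linarith [hc a hxa, distMatrix_le (W := W) hl']

theorem distMatrix_eq_add [Finite V] (hxp : ∃ l, IsDirectedPath G x p l)
    (hpz : ∃ l, IsDirectedPath G p z l) (hmem : ∀ l, IsDirectedPath G x z l → p ∈ l)
    (hdisj : ∀ l₁ l₂, IsDirectedPath G x p (l₁ ++ [p]) → IsDirectedPath G p z (p :: l₂) →
      ∀ a ∈ l₁, a ∉ p :: l₂) :
    distMatrix G W x z = distMatrix G W x p + distMatrix G W p z := by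
  obtain ⟨l₁, h₁, hW₁⟩ := exists_pathWeight_eq_distMatrix W hxp
  obtain ⟨l₂, h₂, hW₂⟩ := exists_pathWeight_eq_distMatrix W hpz
  obtain ⟨l₁, rfl⟩ := h₁.exists_eq_append
  obtain ⟨l₂, rfl⟩ := h₂.exists_eq_cons
  have hjoin := isDirectedPath_append_iff.2 ⟨h₁, h₂, hdisj _ _ h₁ h₂⟩
  apply le_antisymm
  · rw [← hW₁, ← hW₂, ← pathWeight_append]
    exact distMatrix_le hjoin
  · obtain ⟨l, h, hW⟩ := exists_pathWeight_eq_distMatrix W ⟨_, hjoin⟩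
    obtain ⟨k₁, k₂, rfl⟩ := List.append_of_mem (hmem l h)
    obtain ⟨hk₁, hk₂, -⟩ := isDirectedPath_append_iff.1 h
    rw [← hW, pathWeight_append]
    exact add_le_add (distMatrix_le hk₁) (distMatrix_le hk₂)

theorem distMatrix_of_unique_out [Finite V] (hG : ∀ x y, ∃ l, IsDirectedPath G x y l) {x' : V}
    (hout : ∀ a, G.Adj x a ↔ a = x') (hxx' : x ≠ x') (hxy : x ≠ y) :
    distMatrix G W x y = W x x' + distMatrix G W x' y := by
  apply le_antisymm
  · obtain ⟨l, hl, hW⟩ := exists_pathWeight_eq_distMatrix W (hG x' y)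
    have hx := notMem_of_unique_out (fun a => (hout a).1) hxx' hxy hl
    obtain ⟨l, rfl⟩ := hl.exists_eq_cons
    rw [← hW]
    exact distMatrix_le (isDirectedPath_cons_cons_iff.2 ⟨rfl, (hout x').2 rfl, hx, hl⟩)
  · refine le_distMatrix_of_forall_adj (hG x y) hxy fun a ha => ?_
    rw [(hout a).1 ha]

theorem distMatrix_of_unique_in [Finite V] (hG : ∀ x y, ∃ l, IsDirectedPath G x y l) {y' : V}
    (hin : ∀ a, G.Adj a y ↔ a = y') (hyy' : y ≠ y') (hxy : x ≠ y) :
    distMatrix G W x y = distMatrix G W x y' + W y' y := by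
  have hrev (a b : V) : distMatrix G W a b = distMatrix (reverse G) (fun x y => W y x) b a := by
    rw [distMatrix_reverse, Matrix.transpose_apply]
  rw [hrev x y, hrev x y', add_comm]
  refine distMatrix_of_unique_out (fun a b => ?_) hin hyy' hxy.symm
  obtain ⟨l, hl⟩ := hG b a
  exact ⟨l.reverse, isDirectedPath_reverse_iff.2 (l.reverse_reverse.symm ▸ hl)⟩

end Distance

section BlockDistance

variable {V : Type*} {G : Digraph V} {W : V → V → ℝ} {S : Finset V} {x z p : V} {l : List V}

theorem IsDirectedPath.forall_mem_of_isBiconnected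
    (hS : Maximal (IsBiconnected G.toSimpleGraphInclusive) (S : Set V)) (hx : x ∈ S) (hz : z ∈ S)
    (h : IsDirectedPath G x z l) : ∀ a ∈ l, a ∈ S := by
  obtain ⟨w, hw, rfl⟩ := h.exists_walk
  exact fun a => IsBiconnected.mem_of_mem_support hS hx hz hw

theorem IsGate.mem_of_isDirectedPath {S : Set V} (hp : IsGate G.toSimpleGraphInclusive S x p)
    (hz : z ∈ S) (h : IsDirectedPath G x z l) : p ∈ l := by
  obtain ⟨w, -, rfl⟩ := h.exists_walk
  exact hp.2 z hz w

variable [Finite V]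

theorem blockDistMatrix_apply (t : Block G) (a b : t.1) :
    blockDistMatrix G W t a b = distMatrix G W a b := by
  refine (distMatrix_map Subtype.val_injective (fun _ _ => Iff.rfl) fun l hl c hc => ?_).symm
  exact ⟨⟨c, hl.forall_mem_of_isBiconnected (isBlock_iff.1 t.2) a.2 b.2 c hc⟩, rfl⟩

theorem exists_isDirectedPath_induce (hG : ∀ x y, ∃ l, IsDirectedPath G x y l) (t : Block G)
    (a b : t.1) : ∃ l, IsDirectedPath (induce G t.1) a b l := by
  obtain ⟨l, hl⟩ := hG a b
  have hlt := hl.forall_mem_of_isBiconnected (isBlock_iff.1 t.2) a.2 b.2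
  lift l to List t.1 using hlt
  exact ⟨l, (isDirectedPath_map_iff Subtype.val_injective fun _ _ => Iff.rfl).1 hl⟩

theorem distMatrix_eq_add_of_isGate (hG : ∀ x y, ∃ l, IsDirectedPath G x y l) (t : Block G)
    (hp : IsGate G.toSimpleGraphInclusive t.1 x p) (hz : z ∈ t.1) :
    distMatrix G W x z = distMatrix G W x p + distMatrix G W p z := by
  refine distMatrix_eq_add (hG x p) (hG p z) (fun l => hp.mem_of_isDirectedPath hz)
    fun l₁ l₂ h₁ h₂ a ha ha₂ => ?_
  have hat : a ∈ t.1 :=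
    h₂.forall_mem_of_isBiconnected (isBlock_iff.1 t.2) hp.1 hz a ha₂
  -- The part of the first path up to `a` ends in the block, so it already contains the gate.
  obtain ⟨k, k', rfl⟩ := List.append_of_mem ha
  have hka : IsDirectedPath G x a (k ++ [a]) := by
    rw [List.append_assoc, List.cons_append] at h₁
    exact (isDirectedPath_append_iff.1 h₁).1
  have hpk := hp.mem_of_isDirectedPath hat hka
  have hnotMem := (isDirectedPath_append_iff.1 h₁).2.2 p
  simp only [List.mem_append, List.mem_cons, List.not_mem_nil, or_false] at hpk hnotMem
  tauto

end BlockDistance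

section Inverse

variable {ι κ : Type*} [Fintype ι] [DecidableEq ι] [Fintype κ] [DecidableEq κ]

theorem cof_eq_one_dotProduct_adjugate_mulVec_one (D : Matrix ι ι ℝ) :
    cof D = 1 ⬝ᵥ D.adjugate *ᵥ 1 := by
  simp only [cof, dotProduct, Matrix.mulVec, Pi.one_apply, one_mul, mul_one]

theorem cof_submatrix_equiv_self (e : κ ≃ ι) (D : Matrix ι ι ℝ) :
    cof (D.submatrix e e) = cof D := by
  simp only [cof, Matrix.adjugate_submatrix_equiv_self, Matrix.submatrix_apply]
  rw [← e.sum_comp]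
  exact Finset.sum_congr rfl fun x _ => e.sum_comp fun y => D.adjugate (e x) y

theorem cof_eq_zero_of_vecMul_eq_const {D : Matrix ι ι ℝ} {e : ι → ℝ} (he : e ≠ 0)
    (he_sum : e ⬝ᵥ 1 = 0) {c : ℝ} (heD : e ᵥ* D = c • 1) : cof D = 0 := by
  by_cases hc : c = 0
  · -- The adjugate times `1` consists of determinants of `D` with one column replaced by `1`,
    -- and `e` annihilates all columns of these matrices.
    have hcol (i : ι) : (D.updateCol i 1).det = 0 := by
      refine Matrix.exists_vecMul_eq_zero_iff.1 ⟨e, he, ?_⟩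
      ext j
      have hj : e ⬝ᵥ D.col j = 0 := (congrFun heD j).trans (by simp [hc])
      by_cases hij : j = i
      · subst hij
        simpa [Matrix.vecMul, dotProduct] using he_sum
      · simpa [Matrix.vecMul, dotProduct, hij] using hj
    have hadj : D.adjugate *ᵥ 1 = 0 := by
      ext i
      rw [← Matrix.cramer_eq_adjugate_mulVec, Matrix.cramer_apply, hcol, Pi.zero_apply]
    rw [cof_eq_one_dotProduct_adjugate_mulVec_one, hadj, dotProduct_zero]
  · have h : c * cof D = 0 := by
      rw [cof_eq_one_dotProduct_adjugate_mulVec_one, ← smul_eq_mul, ← smul_dotProduct, ← heD,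
        Matrix.dotProduct_mulVec, Matrix.vecMul_vecMul, Matrix.mul_adjugate, Matrix.vecMul_smul,
        Matrix.vecMul_one, smul_dotProduct, he_sum, smul_zero]
    exact (mul_eq_zero.1 h).resolve_left hc

/-- The identities between a matrix `D` and data `λ, α, β, 𝓛` which express the inverse of `D`
(if it exists) and the ratio of `det D` and `cof D` by these data. In contrast to `D⁻¹` they make
sense for a singular `D`, and they are inherited by the composition of the blocks. -/
structure IsLapExpressible (D : Matrix ι ι ℝ) (B : LapData ι) : Prop where
  sum_β : ∑ x, B.β x = 1
  mulVec_β : D *ᵥ B.β = B.lam • 1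
  mul_L : D * B.L = Matrix.vecMulVec 1 B.α - 1
  isLaplacianLike : IsLaplacianLike B.L

namespace IsLapExpressible

variable {D : Matrix ι ι ℝ} {B : LapData ι}

theorem lam_ne_zero (h : IsLapExpressible D B) (hD : D.det ≠ 0) : B.lam ≠ 0 := by
  intro hlam
  have hβ : B.β = 0 := Matrix.eq_zero_of_mulVec_eq_zero hD (by rw [h.mulVec_β, hlam, zero_smul])
  simpa [hβ] using h.sum_β

theorem inv_eq (h : IsLapExpressible D B) (hD : D.det ≠ 0) :
    D⁻¹ = -B.L + (1 / B.lam) • Matrix.vecMulVec B.β B.α := by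
  refine Matrix.inv_eq_right_inv ?_
  rw [Matrix.mul_add, Matrix.mul_neg, Matrix.mul_smul, Matrix.mul_vecMulVec, h.mulVec_β, h.mul_L,
    Matrix.smul_vecMulVec, smul_smul, one_div_mul_cancel (h.lam_ne_zero hD), one_smul]
  abel

theorem det_eq (h : IsLapExpressible D B) : D.det = B.lam * cof D := by
  calc D.det = 1 ⬝ᵥ D.det • B.β := by
        rw [dotProduct_smul, one_dotProduct, h.sum_β, smul_eq_mul, mul_one]
    _ = 1 ⬝ᵥ D.adjugate *ᵥ (D *ᵥ B.β) := by
        rw [Matrix.mulVec_mulVec, Matrix.adjugate_mul, Matrix.smul_mulVec, Matrix.one_mulVec]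
    _ = B.lam * cof D := by
        rw [h.mulVec_β, Matrix.mulVec_smul, dotProduct_smul,
          cof_eq_one_dotProduct_adjugate_mulVec_one, smul_eq_mul]

theorem submatrix (h : IsLapExpressible D B) (e : κ ≃ ι) :
    IsLapExpressible (D.submatrix e e) ⟨B.lam, B.α ∘ e, B.β ∘ e, B.L.submatrix e e⟩ where
  sum_β := (e.sum_comp B.β).trans h.sum_β
  mulVec_β := by
    rw [Matrix.submatrix_mulVec_equiv, Function.comp_assoc, e.self_comp_symm, Function.comp_id,
      h.mulVec_β]
    rfl
  mul_L := by
    rw [Matrix.submatrix_mul_equiv, h.mul_L, Matrix.submatrix_sub]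
    simp only [Pi.sub_apply, Matrix.submatrix_one_equiv]
    rfl
  isLaplacianLike := by
    constructor
    · rw [Matrix.submatrix_mulVec_equiv, Pi.one_comp, h.isLaplacianLike.1, Pi.zero_comp]
    · rw [Matrix.submatrix_vecMul_equiv, Pi.one_comp, h.isLaplacianLike.2, Pi.zero_comp]

end IsLapExpressible

end Inverse

section PartialSum

variable {M : Type*} {N : ℕ}

theorem partialSum_last [AddCommMonoid M] (f : Fin N → M) :
    Fin.partialSum f (Fin.last N) = ∑ i, f i := by
  rw [Fin.partialSum, Fin.val_last, List.take_of_length_le (List.length_ofFn).le, List.sum_ofFn]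

theorem eq_add_partialSum [AddMonoid M] {f : Fin N → M} {F : Fin (N + 1) → M} {k : Fin (N + 1)}
    (hF : ∀ i : Fin N, i.succ ≤ k → F i.succ = F i.castSucc + f i) :
    F k = F 0 + Fin.partialSum f k := by
  induction k using Fin.induction with
  | zero => simp
  | succ i ih =>
    rw [hF i le_rfl, Fin.partialSum_succ, ih fun j hj => hF j (hj.trans (Fin.castSucc_le_succ i)),
      add_assoc]

theorem eq_sum_sub_partialSum_add [AddCommGroup M] {f : Fin N → M} {F : Fin (N + 1) → M}
    {k : Fin (N + 1)} (hF : ∀ i : Fin N, k ≤ i.castSucc → F i.castSucc = f i + F i.succ) :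
    F k = ∑ i, f i - Fin.partialSum f k + F (Fin.last N) := by
  induction k using Fin.reverseInduction with
  | last => rw [partialSum_last, sub_self, zero_add]
  | cast i ih =>
    rw [hF i le_rfl, ih fun j hj => hF j ((Fin.castSucc_le_succ i).trans hj), Fin.partialSum_succ]
    abel

theorem partialSum_eq_sum_filter [AddCommMonoid M] (f : Fin N → M) (k : Fin (N + 1)) :
    Fin.partialSum f k = ∑ i with i.castSucc < k, f i := by
  induction k using Fin.induction with
  | zero => simp
  | succ i ih =>
    have hinsert : ({j | j.castSucc < i.succ} : Finset (Fin N))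
        = insert i ({j | j.castSucc < i.castSucc} : Finset (Fin N)) := by
      ext j
      simp [le_iff_eq_or_lt]
    rw [Fin.partialSum_succ, ih, hinsert, Finset.sum_insert (by simp), add_comm]

theorem pairSum_eq_sum_partialSum_mul (f : Fin N → ℝ) :
    pairSum f = ∑ i, Fin.partialSum f i.castSucc * f i := by
  simp only [pairSum, partialSum_eq_sum_filter, Fin.castSucc_lt_castSucc_iff, Finset.sum_filter,
    Finset.sum_mul, ite_mul, zero_mul, Fintype.sum_prod_type_right]

end PartialSum

namespace DC

variable {n r : ℕ} {m : Fin r → ℕ}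

theorem pathVertex_zero (j : Fin r) : pathVertex (n := n) (m := m) j 0 = .inl (Fin.last n) := rfl

theorem pathVertex_last (j : Fin r) :
    pathVertex (n := n) (m := m) j (Fin.last (m j + 1)) = .inl 0 := by
  rw [← Fin.succ_last]
  exact Fin.lastCases_last (motive := fun _ => DCVert n m)

theorem pathVertex_castSucc_succ (j : Fin r) (k : Fin (m j)) :
    pathVertex (n := n) (m := m) j k.castSucc.succ = .inr ⟨j, k⟩ := by
  simp [pathVertex]

theorem pathVertex_succ_castSucc (j : Fin r) (k : Fin (m j)) :
    pathVertex (n := n) (m := m) j k.succ.castSucc = .inr ⟨j, k⟩ := by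
  rw [← Fin.succ_castSucc, pathVertex_castSucc_succ]

theorem inr_eq_pathVertex_iff {j l : Fin r} {i : Fin (m j)} {k : Fin (m l + 2)} :
    (.inr ⟨j, i⟩ : DCVert n m) = pathVertex l k ↔ j = l ∧ k.val = i.val + 1 := by
  cases k using Fin.cases with
  | zero => simp [pathVertex_zero]
  | succ k =>
    cases k using Fin.lastCases with
    | last =>
      rw [Fin.succ_last, pathVertex_last]
      simp only [reduceCtorEq, Fin.val_last, false_iff, not_and]
      rintro rfl
      omega
    | cast k =>
      rw [pathVertex_castSucc_succ, Sum.inr.injEq, Sigma.mk.injEq]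
      constructor
      · rintro ⟨rfl, h⟩
        simp [eq_of_heq h]
      · rintro ⟨rfl, h⟩
        exact ⟨rfl, heq_of_eq (Fin.ext (by simpa using h.symm))⟩

theorem inl_eq_pathVertex_iff {p : Fin (n + 1)} {l : Fin r} {k : Fin (m l + 2)} :
    (.inl p : DCVert n m) = pathVertex l k ↔
      k = 0 ∧ p = Fin.last n ∨ k = Fin.last (m l + 1) ∧ p = 0 := by
  cases k using Fin.cases with
  | zero =>
    simp only [pathVertex_zero, Sum.inl.injEq, Fin.ext_iff, Fin.val_zero, Fin.val_last]
    grind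
  | succ k =>
    cases k using Fin.lastCases with
    | last =>
      simp only [Fin.succ_last, pathVertex_last, Sum.inl.injEq, Fin.ext_iff, Fin.val_zero,
        Fin.val_last]
      grind
    | cast k =>
      simp only [pathVertex_castSucc_succ, reduceCtorEq, Fin.ext_iff, Fin.val_zero, Fin.val_last,
        Fin.val_succ, Fin.val_castSucc]
      grind

theorem adj_inl_castSucc_iff (i : Fin n) (a : DCVert n m) :
    (dC n m).Adj (.inl i.castSucc) a ↔ a = .inl i.succ := by
  rcases a with q | ⟨j, k⟩
  · simp only [dC, Sum.inl.injEq, Fin.ext_iff, Fin.val_succ, Fin.val_castSucc]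
  · simp [dC, i.isLt.ne]

theorem adj_inl_succ_iff (i : Fin n) (a : DCVert n m) :
    (dC n m).Adj a (.inl i.succ) ↔ a = .inl i.castSucc := by
  rcases a with q | ⟨j, k⟩
  · simp only [dC, Sum.inl.injEq, Fin.ext_iff, Fin.val_succ, Fin.val_castSucc]
    omega
  · simp [dC]

theorem adj_inr_iff (j : Fin r) (k : Fin (m j)) (a : DCVert n m) :
    (dC n m).Adj (.inr ⟨j, k⟩) a ↔ a = pathVertex j k.succ.succ := by
  rcases a with q | ⟨l, i⟩
  · simp only [inl_eq_pathVertex_iff, dC, Fin.ext_iff, Fin.val_succ, Fin.val_last, Fin.val_zero]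
    omega
  · simp only [inr_eq_pathVertex_iff, dC, Fin.val_succ]
    grind

theorem adj_to_inr_iff (j : Fin r) (k : Fin (m j)) (a : DCVert n m) :
    (dC n m).Adj a (.inr ⟨j, k⟩) ↔ a = pathVertex j k.castSucc.castSucc := by
  rcases a with q | ⟨l, i⟩
  · simp only [inl_eq_pathVertex_iff, dC, Fin.ext_iff, Fin.val_castSucc, Fin.val_last, Fin.val_zero]
    omega
  · simp only [inr_eq_pathVertex_iff, dC, Fin.val_castSucc]

theorem not_adj_self (x : DCVert n m) : ¬ (dC n m).Adj x x := by
  rcases x with p | ⟨j, k⟩ <;> simp [dC]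

/-- The vertex that follows `x` on its cycle, for `x ≠ u_n`. The value at `u_n`, which has several
successors, is a dummy. -/
def succ : DCVert n m → DCVert n m
  | .inl i => Fin.lastCases (motive := fun _ => DCVert n m) (.inl i) (fun i => .inl i.succ) i
  | .inr ⟨j, k⟩ => pathVertex j k.succ.succ

/-- The vertex that precedes `x` on its cycle, for `x ≠ u_0`. The value at `u_0`, which has several
predecessors, is a dummy. -/
def pred : DCVert n m → DCVert n m
  | .inl i => Fin.cases (motive := fun _ => DCVert n m) (.inl i) (fun i => .inl i.castSucc) i
  | .inr ⟨j, k⟩ => pathVertex j k.castSucc.castSucc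

theorem succ_inl_castSucc (i : Fin n) : succ (.inl i.castSucc : DCVert n m) = .inl i.succ :=
  Fin.lastCases_castSucc (motive := fun _ => DCVert n m) i

theorem succ_inr (j : Fin r) (k : Fin (m j)) :
    succ (.inr ⟨j, k⟩ : DCVert n m) = pathVertex j k.succ.succ := rfl

theorem pred_inl_succ (i : Fin n) : pred (.inl i.succ : DCVert n m) = .inl i.castSucc := rfl

theorem pred_inr (j : Fin r) (k : Fin (m j)) :
    pred (.inr ⟨j, k⟩ : DCVert n m) = pathVertex j k.castSucc.castSucc := rfl

theorem adj_iff_eq_succ {x : DCVert n m} (hx : x ≠ .inl (Fin.last n)) (a : DCVert n m) :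
    (dC n m).Adj x a ↔ a = succ x := by
  rcases x with i | ⟨j, k⟩
  · cases i using Fin.lastCases with
    | last => exact absurd rfl hx
    | cast i => rw [succ_inl_castSucc, adj_inl_castSucc_iff]
  · exact adj_inr_iff j k a

theorem adj_iff_eq_pred {y : DCVert n m} (hy : y ≠ .inl 0) (a : DCVert n m) :
    (dC n m).Adj a y ↔ a = pred y := by
  rcases y with i | ⟨j, k⟩
  · cases i using Fin.cases with
    | zero => exact absurd rfl hy
    | succ i => rw [pred_inl_succ, adj_inl_succ_iff]
  · exact adj_to_inr_iff j k a

theorem ne_succ {x : DCVert n m} (hx : x ≠ .inl (Fin.last n)) : x ≠ succ x := fun h =>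
  not_adj_self x ((adj_iff_eq_succ hx x).2 h)

theorem ne_pred {y : DCVert n m} (hy : y ≠ .inl 0) : y ≠ pred y := fun h =>
  not_adj_self y ((adj_iff_eq_pred hy y).2 h)

theorem eq_of_forall_eq_succ {R : Type*} {f : DCVert n m → R}
    (hf : ∀ x, x ≠ .inl (Fin.last n) → f x = f (succ x)) (x : DCVert n m) :
    f x = f (.inl (Fin.last n)) := by
  have hinl (i : Fin (n + 1)) : f (.inl i) = f (.inl (Fin.last n)) := by
    induction i using Fin.reverseInduction with
    | last => rfl
    | cast i ih => rw [← ih, ← succ_inl_castSucc]; exact hf _ (by simp [Fin.ext_iff, i.isLt.ne])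
  have hpath (j : Fin r) (k : Fin (m j + 1)) :
      f (pathVertex j k.succ) = f (.inl (Fin.last n)) := by
    induction k using Fin.reverseInduction with
    | last => rw [Fin.succ_last, pathVertex_last, hinl]
    | cast k ih =>
      rw [← ih, ← succ_inr, pathVertex_castSucc_succ]
      exact hf _ (by simp)
  rcases x with i | ⟨j, k⟩
  · exact hinl i
  · rw [← pathVertex_castSucc_succ, hpath]

end DC

theorem eq_of_sum_eq_of_forall_ne {ι M : Type*} [Fintype ι] [AddCommMonoid M]
    [IsRightCancelAdd M] {f g : ι → M} {i : ι} (hsum : ∑ j, f j = ∑ j, g j)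
    (hne : ∀ j, j ≠ i → f j = g j) : f = g := by
  classical
  ext j
  by_cases hj : j = i
  · subst hj
    rw [← Finset.add_sum_erase _ _ (Finset.mem_univ j),
      ← Finset.add_sum_erase _ g (Finset.mem_univ j),
      Finset.sum_congr rfl fun k hk => hne k (Finset.ne_of_mem_erase hk)] at hsum
    exact add_right_cancel hsum
  · exact hne j hj

namespace DC

variable {n r : ℕ} {m : Fin r → ℕ} (W : DCVert n m → DCVert n m → ℝ) (j₁ : Fin r)

/-- The weight of the cycle through `x`. The vertices of the common path, which lie on all cycles,
are assigned to the cycle number `j₁`. -/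
def cycleWeight : DCVert n m → ℝ
  | .inl _ => w W j₁
  | .inr ⟨j, _⟩ => w W j

theorem alpha_eq_div {y : DCVert n m} (hy : y ≠ .inl 0) :
    alpha W j₁ y = W (pred y) y / cycleWeight W j₁ y := by
  rcases y with i | ⟨j, k⟩
  · cases i using Fin.cases with
    | zero => exact absurd rfl hy
    | succ i => rfl
  · rw [alpha, ownWeight, ← Fin.castSucc_succ, pathVertex_succ_castSucc, pred_inr, cycleWeight]

theorem beta_eq_div {x : DCVert n m} (hx : x ≠ .inl (Fin.last n)) :
    beta W j₁ x = W x (succ x) / cycleWeight W j₁ x := by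
  rcases x with i | ⟨j, k⟩
  · cases i using Fin.lastCases with
    | last => exact absurd rfl hx
    | cast i => simp [beta, succ_inl_castSucc, commonWeight, cycleWeight]
  · rw [beta, ownWeight, pathVertex_succ_castSucc, succ_inr, cycleWeight]

variable {W j₁}

theorem cycleWeight_ne_zero (hw : ∀ j, w W j ≠ 0) : ∀ x, cycleWeight W j₁ x ≠ 0
  | .inl _ => hw j₁
  | .inr ⟨j, _⟩ => hw j

theorem adj_apply_eq_ite_succ {x : DCVert n m} (hx : x ≠ .inl (Fin.last n)) (y : DCVert n m) :
    adj W j₁ x y = if y = succ x then 1 / cycleWeight W j₁ x else 0 := by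
  classical
  simp only [adj, Matrix.of_apply, adj_iff_eq_succ hx]
  refine ite_congr rfl (fun hy => ?_) fun _ => rfl
  rcases x with i | _
  · cases i using Fin.lastCases with
    | last => exact absurd rfl hx
    | cast i => rw [hy, succ_inl_castSucc]; rfl
  · rfl

theorem adj_apply_eq_ite_pred {y : DCVert n m} (hy : y ≠ .inl 0) (x : DCVert n m) :
    adj W j₁ x y = if x = pred y then 1 / cycleWeight W j₁ y else 0 := by
  by_cases hxy : (dC n m).Adj x y
  · rw [if_pos ((adj_iff_eq_pred hy x).1 hxy), adj, Matrix.of_apply, if_pos hxy]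
    rcases x with p | ⟨j, i⟩ <;> rcases y with q | ⟨l, k⟩
    · rfl
    · rfl
    · exact absurd (congrArg Sum.inl (Fin.ext hxy.2)) hy
    · obtain ⟨rfl, -⟩ := hxy
      rfl
  · rw [if_neg fun h => hxy ((adj_iff_eq_pred hy x).2 h), adj, Matrix.of_apply, if_neg hxy]

theorem sum_adj {x : DCVert n m} (hx : x ≠ .inl (Fin.last n)) :
    ∑ y, adj W j₁ x y = 1 / cycleWeight W j₁ x := by
  simp [adj_apply_eq_ite_succ hx]

theorem sum_adj_last (hm : ∀ j, 1 ≤ m j) :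
    ∑ y, adj W j₁ (.inl (Fin.last n)) y = ∑ j, 1 / w W j := by
  have hinl (i : Fin (n + 1)) : adj W j₁ (.inl (Fin.last n)) (.inl i) = 0 :=
    if_neg fun h : i.val = n + 1 => absurd i.isLt (by omega)
  have hinr (j : Fin r) : ∑ k, adj W j₁ (.inl (Fin.last n)) (.inr ⟨j, k⟩) = 1 / w W j :=
    (Fintype.sum_eq_single ⟨0, hm j⟩ fun k hk => if_neg fun h : n = n ∧ k.val = 0 =>
      hk (Fin.ext h.2)).trans (if_pos ⟨rfl, rfl⟩)
  simp only [Fintype.sum_sum_type, Fintype.sum_sigma, hinl, hinr, Finset.sum_const_zero, zero_add]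

theorem inl_last_ne_inl_zero (hn : 1 ≤ n) : (.inl (Fin.last n) : DCVert n m) ≠ .inl 0 := by
  simp only [ne_eq, Sum.inl.injEq, Fin.ext_iff, Fin.val_last, Fin.val_zero]
  omega

theorem lap_apply_self (hn : 1 ≤ n) (hm : ∀ j, 1 ≤ m j) (y : DCVert n m) :
    lap W j₁ y y = 1 / cycleWeight W j₁ y := by
  have hadj : adj W j₁ y y = 0 := if_neg (not_adj_self y)
  rw [lap, Matrix.add_apply, Matrix.sub_apply, Matrix.diagonal_apply_eq, hadj, sub_zero]
  by_cases hy : y = .inl (Fin.last n)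
  · subst hy
    rw [sum_adj_last hm, perturbation, Matrix.of_apply,
      if_neg fun h => inl_last_ne_inl_zero hn h.2, if_pos ⟨rfl, rfl⟩,
      ← Finset.add_sum_erase _ _ (Finset.mem_univ j₁), add_neg_cancel_right, cycleWeight]
  · rw [sum_adj hy, perturbation, Matrix.of_apply, if_neg fun h => hy h.1,
      if_neg fun h => hy h.1, add_zero]

theorem lap_apply (hn : 1 ≤ n) (hm : ∀ j, 1 ≤ m j) {y : DCVert n m} (hy : y ≠ .inl 0)
    (x : DCVert n m) :
    lap W j₁ x y
      = ((if x = y then 1 else 0) - if x = pred y then 1 else 0) / cycleWeight W j₁ y := by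
  by_cases hxy : x = y
  · subst hxy
    rw [lap_apply_self hn hm, if_pos rfl, if_neg (ne_pred hy), sub_zero]
  · have hpert : perturbation W j₁ x y = 0 := by
      rw [perturbation, Matrix.of_apply, if_neg fun h => hy h.2,
        if_neg fun h => hxy (h.1.trans h.2.symm)]
    rw [lap, Matrix.add_apply, Matrix.sub_apply, Matrix.diagonal_apply_ne _ hxy, hpert,
      adj_apply_eq_ite_pred hy, if_neg hxy]
    split_ifs <;> ring

theorem sum_perturbation (hn : 1 ≤ n) (x : DCVert n m) : ∑ y, perturbation W j₁ x y = 0 := by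
  have hite (y : DCVert n m) (a : ℝ) :
      (if y = .inl 0 then a else if y = .inl (Fin.last n) then -a else 0)
        = (if y = .inl 0 then a else 0) + if y = .inl (Fin.last n) then -a else 0 := by
    have := inl_last_ne_inl_zero (m := m) hn
    split_ifs <;> simp_all
  by_cases hx : x = .inl (Fin.last n)
  · simp only [perturbation, Matrix.of_apply, hx, true_and, hite, Finset.sum_add_distrib,
      Finset.sum_ite_eq', Finset.mem_univ, if_true, add_neg_cancel]
  · simp only [perturbation, Matrix.of_apply, hx, false_and, if_false, Finset.sum_const_zero]

theorem lap_mulVec_one (hn : 1 ≤ n) : lap W j₁ *ᵥ 1 = 0 := by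
  ext x
  simp only [lap, Matrix.mulVec, dotProduct, Matrix.add_apply, Matrix.sub_apply,
    Matrix.diagonal_apply, Pi.one_apply, mul_one, Finset.sum_add_distrib, Finset.sum_sub_distrib,
    Finset.sum_ite_eq, Finset.mem_univ, if_true, sum_perturbation hn, sub_self, add_zero,
    Pi.zero_apply]

theorem one_vecMul_lap (hn : 1 ≤ n) (hm : ∀ j, 1 ≤ m j) : 1 ᵥ* lap W j₁ = 0 := by
  have hcol (y : DCVert n m) (hy : y ≠ .inl 0) : (1 ᵥ* lap W j₁) y = 0 := by
    simp only [Matrix.vecMul, dotProduct, Pi.one_apply, one_mul, lap_apply hn hm hy,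
      ← Finset.sum_div, Finset.sum_sub_distrib, Finset.sum_ite_eq', Finset.mem_univ, if_true,
      sub_self, zero_div]
  refine eq_of_sum_eq_of_forall_ne (i := .inl 0) ?_ hcol
  rw [← dotProduct_one, ← Matrix.dotProduct_mulVec, lap_mulVec_one hn, dotProduct_zero,
    ← dotProduct_one, zero_dotProduct]

theorem isLaplacianLike_lap (hn : 1 ≤ n) (hm : ∀ j, 1 ≤ m j) : IsLaplacianLike (lap W j₁) :=
  ⟨lap_mulVec_one hn, one_vecMul_lap hn hm⟩

theorem sum_alpha (hw : w W j₁ ≠ 0) : ∑ y, alpha W j₁ y = 1 := by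
  have hown : ∑ j, wHat W j / w W j
      = ∑ j, ∑ k : Fin (m j), ownWeight W j k.castSucc / w W j
        + ∑ j, ownWeight W j (Fin.last (m j)) / w W j := by
    simp only [wHat, Fin.sum_univ_castSucc, add_div, Finset.sum_div, Finset.sum_add_distrib]
  rw [← Finset.add_sum_erase _ _ (Finset.mem_univ j₁)] at hown
  have hcycle : (∑ i, commonWeight W i) / w W j₁ + wHat W j₁ / w W j₁ = 1 := by
    rw [← add_div]
    exact div_self hw
  simp only [Fintype.sum_sum_type, Fintype.sum_sigma, Fin.sum_univ_succ, alpha, Fin.cases_zero,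
    Fin.cases_succ, ← Finset.sum_div (s := (Finset.univ : Finset (Fin n)))]
  linarith

theorem sum_beta (hw : w W j₁ ≠ 0) : ∑ x, beta W j₁ x = 1 := by
  have hown : ∑ j, wHat W j / w W j
      = ∑ j, ownWeight W j 0 / w W j
        + ∑ j, ∑ k : Fin (m j), ownWeight W j k.succ / w W j := by
    simp only [wHat, Fin.sum_univ_succ, add_div, Finset.sum_div, Finset.sum_add_distrib]
  rw [← Finset.add_sum_erase _ _ (Finset.mem_univ j₁)] at hown
  have hcycle : (∑ i, commonWeight W i) / w W j₁ + wHat W j₁ / w W j₁ = 1 := by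
    rw [← add_div]
    exact div_self hw
  simp only [Fintype.sum_sum_type, Fintype.sum_sigma, Fin.sum_univ_castSucc, beta,
    Fin.lastCases_last, Fin.lastCases_castSucc,
    ← Finset.sum_div (s := (Finset.univ : Finset (Fin n)))]
  linarith

section Distances

variable {n r : ℕ} {m : Fin r → ℕ} {W : DCVert n m → DCVert n m → ℝ} {j₁ : Fin r}

theorem pathVertex_injective (hn : 1 ≤ n) (j : Fin r) :
    Function.Injective (pathVertex (n := n) (m := m) j) := by
  intro k l hkl
  rcases h : pathVertex (n := n) (m := m) j k with p | ⟨l', i⟩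
  · have hk := inl_eq_pathVertex_iff.1 h.symm
    have hl := inl_eq_pathVertex_iff.1 (h.symm.trans hkl)
    grind
  · have hk := inr_eq_pathVertex_iff.1 h.symm
    have hl := inr_eq_pathVertex_iff.1 (h.symm.trans hkl)
    exact Fin.ext (hk.2.trans hl.2.symm)

theorem adj_pathVertex (hm : ∀ j, 1 ≤ m j) (j : Fin r) (i : Fin (m j + 1)) :
    (dC n m).Adj (pathVertex j i.castSucc) (pathVertex j i.succ) := by
  cases i using Fin.cases with
  | zero =>
    have h : pathVertex (n := n) (m := m) j (Fin.succ 0) = .inr ⟨j, ⟨0, hm j⟩⟩ :=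
      (inr_eq_pathVertex_iff.2 ⟨rfl, rfl⟩).symm
    rw [h]
    exact ⟨rfl, rfl⟩
  | succ i => rw [pathVertex_succ_castSucc, adj_inr_iff]

variable (hG : ∀ x y, ∃ l, IsDirectedPath (dC n m) x y l)
include hG

theorem distMatrix_eq_add_succ {x y : DCVert n m} (hx : x ≠ .inl (Fin.last n)) (hxy : x ≠ y) :
    distMatrix (dC n m) W x y = W x (succ x) + distMatrix (dC n m) W (succ x) y :=
  distMatrix_of_unique_out hG (adj_iff_eq_succ hx) (ne_succ hx) hxy

theorem distMatrix_eq_pred_add {x y : DCVert n m} (hy : y ≠ .inl 0) (hxy : x ≠ y) :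
    distMatrix (dC n m) W x y = distMatrix (dC n m) W x (pred y) + W (pred y) y :=
  distMatrix_of_unique_in hG (adj_iff_eq_pred hy) (ne_pred hy) hxy

theorem distMatrix_inl_left {i : Fin (n + 1)} {z : DCVert n m}
    (hz : ∀ k : Fin n, i ≤ k.castSucc → .inl k.castSucc ≠ z) :
    distMatrix (dC n m) W (.inl i) z = wc W - Fin.partialSum (commonWeight W) i
      + distMatrix (dC n m) W (.inl (Fin.last n)) z := by
  refine eq_sum_sub_partialSum_add (F := fun i => distMatrix (dC n m) W (.inl i) z) fun k hk => ?_
  have hk_ne : (.inl k.castSucc : DCVert n m) ≠ .inl (Fin.last n) := by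
    simp [Fin.ext_iff, k.isLt.ne]
  have h := distMatrix_eq_add_succ (W := W) hG hk_ne (hz k hk)
  rwa [succ_inl_castSucc] at h

theorem distMatrix_pathVertex_left {j : Fin r} {k : Fin (m j + 2)} (hk : k ≠ 0) {z : DCVert n m}
    (hz : ∀ i : Fin (m j), k ≤ i.succ.castSucc → .inr ⟨j, i⟩ ≠ z) :
    distMatrix (dC n m) W (pathVertex j k) z = wHat W j - Fin.partialSum (ownWeight W j) k
      + distMatrix (dC n m) W (.inl 0) z := by
  rw [← pathVertex_last j]
  refine eq_sum_sub_partialSum_add (F := fun i => distMatrix (dC n m) W (pathVertex j i) z)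
    fun i hi => ?_
  cases i using Fin.cases with
  | zero => exact absurd (Fin.le_zero_iff.1 hi) hk
  | succ i =>
    have h := distMatrix_eq_add_succ (W := W) hG Sum.inr_ne_inl (hz i hi)
    rw [succ_inr] at h
    rw [ownWeight, pathVertex_succ_castSucc, h]

theorem distMatrix_last_pathVertex {j : Fin r} {k : Fin (m j + 2)} (hk : k ≠ Fin.last (m j + 1)) :
    distMatrix (dC n m) W (.inl (Fin.last n)) (pathVertex j k)
      = Fin.partialSum (ownWeight W j) k := by
  have h := eq_add_partialSum (f := ownWeight W j) (k := k)
    (F := fun i => distMatrix (dC n m) W (.inl (Fin.last n)) (pathVertex j i)) fun i hi => ?_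
  · simpa only [pathVertex_zero, distMatrix_self, zero_add] using h
  cases i using Fin.lastCases with
  | last => exact absurd (Fin.last_le_iff.1 hi) hk
  | cast i =>
    have h := distMatrix_eq_pred_add (W := W) (y := .inr ⟨j, i⟩) hG Sum.inr_ne_inl
      (Sum.inl_ne_inr (a := Fin.last n))
    rw [pred_inr] at h
    rw [ownWeight, pathVertex_castSucc_succ, h]

theorem distMatrix_zero_pathVertex {j : Fin r} {k : Fin (m j + 2)} (hk : k ≠ Fin.last (m j + 1)) :
    distMatrix (dC n m) W (.inl 0) (pathVertex j k)
      = wc W + Fin.partialSum (ownWeight W j) k := by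
  rw [distMatrix_inl_left hG, distMatrix_last_pathVertex hG hk, Fin.partialSum_zero, sub_zero]
  intro i _ h
  rcases inl_eq_pathVertex_iff.1 h with ⟨-, h⟩ | ⟨h, -⟩
  · exact (Fin.castSucc_lt_last i).ne h
  · exact hk h

theorem distMatrix_pathVertex_succ_castSucc (j : Fin r) (i : Fin (m j + 1)) :
    distMatrix (dC n m) W (pathVertex j i.succ) (pathVertex j i.castSucc)
      = w W j - ownWeight W j i := by
  rw [distMatrix_pathVertex_left hG (Fin.succ_ne_zero i),
    distMatrix_zero_pathVertex hG (Fin.castSucc_lt_last i).ne, Fin.partialSum_succ, w]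
  · ring
  · intro k hk h
    have := (inr_eq_pathVertex_iff.1 h).2
    simp only [Fin.le_def, Fin.val_succ, Fin.val_castSucc] at hk this
    omega

theorem distMatrix_last_zero (hn : 1 ≤ n) (hm : ∀ j, 1 ≤ m j) (hj₁ : ∀ j, w W j₁ ≤ w W j) :
    distMatrix (dC n m) W (.inl (Fin.last n)) (.inl 0) = wHat W j₁ := by
  apply le_antisymm
  · have hpath := isDirectedPath_ofFn (pathVertex_injective hn j₁) (adj_pathVertex hm j₁)
    rw [pathVertex_zero, pathVertex_last] at hpath
    exact (distMatrix_le hpath).trans_eq (pathWeight_ofFn W _)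
  · refine le_distMatrix_of_forall_adj (hG _ _) (inl_last_ne_inl_zero hn) fun a ha => ?_
    rcases a with i | ⟨j, k⟩
    · have hi : i.val = n + 1 := ha
      omega
    · have hk : (.inr ⟨j, k⟩ : DCVert n m) = pathVertex j (Fin.succ 0) :=
        inr_eq_pathVertex_iff.2 ⟨rfl, by simp [show k.val = 0 from ha.2]⟩
      have hown : W (.inl (Fin.last n)) (pathVertex j (Fin.succ 0)) = ownWeight W j 0 := rfl
      rw [hk, distMatrix_pathVertex_left hG (Fin.succ_ne_zero _) fun _ _ => Sum.inr_ne_inl,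
        distMatrix_self, Fin.partialSum_succ, hown, Fin.castSucc_zero, Fin.partialSum_zero]
      have := hj₁ j
      simp only [w] at this
      linarith

theorem distMatrix_last_inl (hn : 1 ≤ n) (hm : ∀ j, 1 ≤ m j) (hj₁ : ∀ j, w W j₁ ≤ w W j)
    {i : Fin (n + 1)} (hi : i ≠ Fin.last n) :
    distMatrix (dC n m) W (.inl (Fin.last n)) (.inl i)
      = wHat W j₁ + Fin.partialSum (commonWeight W) i := by
  rw [← distMatrix_last_zero hG hn hm hj₁]
  refine eq_add_partialSum (F := fun i => distMatrix (dC n m) W (.inl (Fin.last n)) (.inl i))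
    fun k hk => ?_
  refine distMatrix_eq_pred_add (y := .inl k.succ) hG (by simp [Fin.ext_iff]) fun h => hi ?_
  rw [← Sum.inl.inj h] at hk
  exact Fin.last_le_iff.1 hk

theorem distMatrix_inl_succ_castSucc (hn : 1 ≤ n) (hm : ∀ j, 1 ≤ m j)
    (hj₁ : ∀ j, w W j₁ ≤ w W j) (i : Fin n) :
    distMatrix (dC n m) W (.inl i.succ) (.inl i.castSucc) = w W j₁ - commonWeight W i := by
  rw [distMatrix_inl_left hG, distMatrix_last_inl hG hn hm hj₁ (Fin.castSucc_lt_last i).ne,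
    Fin.partialSum_succ, w]
  · ring
  · intro k hk h
    rw [Sum.inl.inj h] at hk
    exact absurd hk (Fin.castSucc_lt_succ).not_ge

theorem distMatrix_sub_succ (hn : 1 ≤ n) (hm : ∀ j, 1 ≤ m j) (hj₁ : ∀ j, w W j₁ ≤ w W j)
    {x : DCVert n m} (hx : x ≠ .inl (Fin.last n)) (y : DCVert n m) :
    distMatrix (dC n m) W x y - distMatrix (dC n m) W (succ x) y
      = W x (succ x) - if y = x then cycleWeight W j₁ x else 0 := by
  by_cases hxy : x = y
  · subst hxy
    rw [distMatrix_self, if_pos rfl]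
    rcases x with i | ⟨j, k⟩
    · cases i using Fin.lastCases with
      | last => exact absurd rfl hx
      | cast i =>
        rw [succ_inl_castSucc, distMatrix_inl_succ_castSucc hG hn hm hj₁, commonWeight,
          cycleWeight]
        ring
    · have h := distMatrix_pathVertex_succ_castSucc (W := W) hG j k.succ
      rw [ownWeight, pathVertex_succ_castSucc] at h
      rw [succ_inr, h, cycleWeight]
      ring
  · rw [distMatrix_eq_add_succ hG hx hxy, if_neg (Ne.symm hxy)]
    ring

theorem distMatrix_sub_pred (hn : 1 ≤ n) (hm : ∀ j, 1 ≤ m j) (hj₁ : ∀ j, w W j₁ ≤ w W j)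
    {y : DCVert n m} (hy : y ≠ .inl 0) (x : DCVert n m) :
    distMatrix (dC n m) W x y - distMatrix (dC n m) W x (pred y)
      = W (pred y) y - if x = y then cycleWeight W j₁ y else 0 := by
  by_cases hxy : x = y
  · subst hxy
    rw [distMatrix_self, if_pos rfl]
    rcases x with i | ⟨j, k⟩
    · cases i using Fin.cases with
      | zero => exact absurd rfl hy
      | succ i =>
        rw [pred_inl_succ, distMatrix_inl_succ_castSucc hG hn hm hj₁, commonWeight, cycleWeight]
        ring
    · have h := distMatrix_pathVertex_succ_castSucc (W := W) hG j k.castSucc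
      rw [ownWeight, pathVertex_castSucc_succ] at h
      rw [pred_inr, h, cycleWeight]
      ring
  · rw [distMatrix_eq_pred_add hG hy hxy, if_neg hxy]
    ring

end Distances

section Expressible

variable {n r : ℕ} {m : Fin r → ℕ} {W : DCVert n m → DCVert n m → ℝ} {j₁ : Fin r}
  (hG : ∀ x y, ∃ l, IsDirectedPath (dC n m) x y l) (hn : 1 ≤ n) (hm : ∀ j, 1 ≤ m j)
  (hj₁ : ∀ j, w W j₁ ≤ w W j)
include hG hn hm hj₁

theorem sum_distMatrix_last_mul_beta :
    ∑ z, distMatrix (dC n m) W (.inl (Fin.last n)) z * beta W j₁ z = lam W j₁ := by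
  have hcommon (i : Fin n) :
      distMatrix (dC n m) W (.inl (Fin.last n)) (.inl i.castSucc) * beta W j₁ (.inl i.castSucc)
        = (commonWeight W i * wHat W j₁
          + Fin.partialSum (commonWeight W) i.castSucc * commonWeight W i) / w W j₁ := by
    rw [distMatrix_last_inl hG hn hm hj₁ (Fin.castSucc_lt_last i).ne, beta,
      Fin.lastCases_castSucc]
    ring
  have hown (j : Fin r) (i : Fin (m j)) :
      distMatrix (dC n m) W (.inl (Fin.last n)) (.inr ⟨j, i⟩) * beta W j₁ (.inr ⟨j, i⟩)
        = Fin.partialSum (ownWeight W j) i.succ.castSucc * ownWeight W j i.succ / w W j := by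
    rw [← pathVertex_succ_castSucc, distMatrix_last_pathVertex hG (Fin.castSucc_lt_last _).ne,
      pathVertex_succ_castSucc, beta, mul_div_assoc]
  have hpairSum (j : Fin r) :
      ∑ i : Fin (m j), Fin.partialSum (ownWeight W j) i.succ.castSucc * ownWeight W j i.succ
        = pairSum (ownWeight W j) := by
    rw [pairSum_eq_sum_partialSum_mul, Fin.sum_univ_succ, Fin.castSucc_zero, Fin.partialSum_zero,
      zero_mul, zero_add]
  simp only [Fintype.sum_sum_type, Fintype.sum_sigma, Fin.sum_univ_castSucc, hcommon, hown,
    distMatrix_self, zero_mul, add_zero, ← Finset.sum_div, hpairSum, Finset.sum_add_distrib,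
    ← Finset.sum_mul, ← pairSum_eq_sum_partialSum_mul, lam, wc, add_div]

theorem w_ne_zero_of_cof_ne_zero (hcof : cof (distMatrix (dC n m) W) ≠ 0) (j : Fin r) :
    w W j ≠ 0 := by
  intro hwj
  -- Then the rows of `v_1` and of its successor differ by a constant.
  set x : DCVert n m := .inr ⟨j, ⟨0, hm j⟩⟩
  have hx : x ≠ .inl (Fin.last n) := Sum.inr_ne_inl
  refine hcof (cof_eq_zero_of_vecMul_eq_const (e := Pi.single x 1 - Pi.single (succ x) 1)
    (c := W x (succ x)) (fun he => ?_) ?_ ?_)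
  · simpa [ne_succ hx] using congrFun he x
  · simp [sub_dotProduct]
  · ext y
    have hcycle : cycleWeight W j₁ x = 0 := hwj
    have h := distMatrix_sub_succ hG hn hm hj₁ hx y
    rw [hcycle, ite_self, sub_zero] at h
    rw [Matrix.sub_vecMul, Matrix.single_one_vecMul, Matrix.single_one_vecMul]
    simpa using h

variable (hw : ∀ j, w W j ≠ 0)
include hw

theorem distMatrix_mulVec_beta : distMatrix (dC n m) W *ᵥ beta W j₁ = lam W j₁ • 1 := by
  ext x
  rw [eq_of_forall_eq_succ (f := distMatrix (dC n m) W *ᵥ beta W j₁) (fun x hx => ?_) x]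
  · rw [Pi.smul_apply, Pi.one_apply, smul_eq_mul, mul_one]
    exact sum_distMatrix_last_mul_beta hG hn hm hj₁
  have hcycle := cycleWeight_ne_zero (j₁ := j₁) hw x
  rw [← sub_eq_zero]
  simp only [Matrix.mulVec, dotProduct, ← Finset.sum_sub_distrib, ← sub_mul,
    distMatrix_sub_succ hG hn hm hj₁ hx]
  simp only [sub_mul, ite_mul, zero_mul, Finset.sum_sub_distrib, ← Finset.mul_sum,
    sum_beta (hw j₁), Finset.sum_ite_eq', Finset.mem_univ, if_true, beta_eq_div W j₁ hx]
  field_simp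
  ring

theorem distMatrix_mul_lap :
    distMatrix (dC n m) W * lap W j₁ = Matrix.vecMulVec 1 (alpha W j₁) - 1 := by
  refine funext fun x => ?_
  -- The column of `u_0` needs no computation since both sides have row sums `0`.
  refine eq_of_sum_eq_of_forall_ne (i := Sum.inl 0) ?_ fun y hy => ?_
  · trans 0
    · rw [← dotProduct_one]
      change ((distMatrix (dC n m) W * lap W j₁) *ᵥ 1) x = 0
      rw [← Matrix.mulVec_mulVec, lap_mulVec_one hn, Matrix.mulVec_zero, Pi.zero_apply]
    · simp only [Matrix.sub_apply, Matrix.vecMulVec_apply, Pi.one_apply, one_mul,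
        Finset.sum_sub_distrib, sum_alpha (hw j₁), Matrix.one_apply, Finset.sum_ite_eq,
        Finset.mem_univ, if_true, sub_self]
  · have hcycle := cycleWeight_ne_zero (j₁ := j₁) hw y
    simp only [Matrix.mul_apply, lap_apply hn hm hy, ← mul_div_assoc, ← Finset.sum_div, mul_sub,
      mul_ite, mul_one, mul_zero, Finset.sum_sub_distrib, Finset.sum_ite_eq', Finset.mem_univ,
      if_true, distMatrix_sub_pred hG hn hm hj₁ hy x, Matrix.sub_apply, Matrix.vecMulVec_apply,
      Pi.one_apply, one_mul, Matrix.one_apply, alpha_eq_div W j₁ hy]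
    split_ifs <;> simp [sub_div, hcycle]

theorem isLapExpressible : IsLapExpressible (distMatrix (dC n m) W)
    ⟨lam W j₁, alpha W j₁, beta W j₁, lap W j₁⟩ where
  sum_β := sum_beta (hw j₁)
  mulVec_β := distMatrix_mulVec_beta hG hn hm hj₁ hw
  mul_L := distMatrix_mul_lap hG hn hm hj₁ hw
  isLaplacianLike := isLaplacianLike_lap hn hm

end Expressible

end DC

section Reorder

variable {n r : ℕ} (m : Fin r → ℕ) (σ : Equiv.Perm (Fin r))

/-- The bijection between the vertices of `dC(n; m_{σ 1}, …, m_{σ r})` and those of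
`dC(n; m₁, …, m_r)` that renumbers the paths from `u_n` to `u_0`. -/
def reorderEquiv : DCVert n (m ∘ σ) ≃ DCVert n m :=
  Equiv.sumCongr (Equiv.refl _) (Equiv.sigmaCongrLeft (β := fun j => Fin (m j)) σ)

theorem adj_reorderEquiv_iff (x y : DCVert n (m ∘ σ)) :
    (dC n m).Adj (reorderEquiv m σ x) (reorderEquiv m σ y) ↔ (dC n (m ∘ σ)).Adj x y := by
  rcases x with p | ⟨j, i⟩ <;> rcases y with q | ⟨l, k⟩
  · rfl
  · rfl
  · rfl
  · exact and_congr_left' σ.injective.eq_iff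

theorem reorderEquiv_pathVertex (j : Fin r) (i : Fin (m (σ j) + 2)) :
    reorderEquiv (n := n) m σ (DC.pathVertex (m := m ∘ σ) j i) = DC.pathVertex (σ j) i := by
  induction i using Fin.cases with
  | zero => rfl
  | succ i =>
    induction i using Fin.lastCases with
    | last =>
      exact (congrArg (reorderEquiv m σ) (DC.pathVertex_last (m := m ∘ σ) j)).trans
        (DC.pathVertex_last (σ j)).symm
    | cast i =>
      exact (congrArg (reorderEquiv m σ) (DC.pathVertex_castSucc_succ (m := m ∘ σ) j i)).trans
        (DC.pathVertex_castSucc_succ (σ j) i).symm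

end Reorder

namespace DCPresentation

variable {U : Type*} {G : Digraph U} (P : DCPresentation G) (W : U → U → ℝ)

/-- The presentation in which the paths from `u_n` to `u_0` are renumbered by `σ`. -/
def reorder (σ : Equiv.Perm (Fin P.r)) : DCPresentation G where
  n := P.n
  r := P.r
  m := P.m ∘ σ
  one_le_n := P.one_le_n
  one_le_r := P.one_le_r
  one_le_m j := P.one_le_m (σ j)
  iso := RelIso.trans ⟨reorderEquiv P.m σ, adj_reorderEquiv_iff P.m σ _ _⟩ P.iso

theorem w_reorder (σ : Equiv.Perm (Fin P.r)) :
    DC.w ((P.reorder σ).weight W) = DC.w (P.weight W) ∘ σ := by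
  ext j
  have hown (i : Fin (P.m (σ j) + 1)) : DC.ownWeight ((P.reorder σ).weight W) j i
      = DC.ownWeight (P.weight W) (σ j) i :=
    congrArg₂ (P.weight W) (reorderEquiv_pathVertex P.m σ j i.castSucc)
      (reorderEquiv_pathVertex P.m σ j i.succ)
  exact congrArg (DC.wc (P.weight W) + ·) (Finset.sum_congr rfl fun i _ => hown i)

include P in
theorem exists_isOrdered : ∃ P' : DCPresentation G, P'.IsOrdered W := by
  refine ⟨P.reorder (Tuple.sort (DC.w (P.weight W))), ?_⟩
  rw [IsOrdered, w_reorder]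
  exact Tuple.monotone_sort _

theorem exists_isDirectedPath_dC (hG : ∀ x y, ∃ l, IsDirectedPath G x y l)
    (x y : DCVert P.n P.m) : ∃ l, IsDirectedPath (dC P.n P.m) x y l := by
  obtain ⟨l, hl⟩ := hG (P.iso x) (P.iso y)
  refine ⟨l.map P.iso.symm, (isDirectedPath_map_iff P.iso.injective
    fun _ _ => P.iso.map_rel_iff.symm).1 ?_⟩
  rwa [List.map_map, P.iso.self_comp_symm, List.map_id]

theorem distMatrix_eq_submatrix :
    distMatrix G W = (distMatrix (dC P.n P.m) (P.weight W)).submatrix P.iso.symm P.iso.symm := by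
  ext x y
  have h := distMatrix_map (W := P.weight W) (a := x) (b := y) P.iso.symm.injective
    (fun _ _ => P.iso.symm.map_rel_iff.symm) fun _ _ c _ => P.iso.symm.surjective c
  simpa only [weight, RelIso.apply_symm_apply, Matrix.submatrix_apply] using h.symm

variable [Fintype U] [DecidableEq U]

theorem isLapExpressible (hG : ∀ x y, ∃ l, IsDirectedPath G x y l)
    (hcof : cof (distMatrix G W) ≠ 0) (hP : P.IsOrdered W) :
    IsLapExpressible (distMatrix G W) (P.lapData W) := by
  have hpath := P.exists_isDirectedPath_dC hG
  have hfirst (j : Fin P.r) : DC.w (P.weight W) P.first ≤ DC.w (P.weight W) j :=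
    hP (Nat.zero_le j.val)
  rw [P.distMatrix_eq_submatrix] at hcof ⊢
  have hw := DC.w_ne_zero_of_cof_ne_zero hpath P.one_le_n P.one_le_m hfirst
    (cof_submatrix_equiv_self P.iso.symm.toEquiv _ ▸ hcof)
  exact (DC.isLapExpressible hpath P.one_le_n P.one_le_m hfirst hw).submatrix P.iso.symm.toEquiv

end DCPresentation

section BlockInclusion

variable {V : Type*} [DecidableEq V] {G : Digraph V}

/-- The matrix of the inclusion of the block `t` into `V`: multiplication by it extends a vector by
zero, and multiplication by its transpose restricts a vector to `t`. -/
def blockInclusion (t : Block G) : Matrix V t.1 ℝ :=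
  Matrix.of fun v z => if v = z then 1 else 0

theorem blockInclusion_mulVec_apply (t : Block G) (f : t.1 → ℝ) (v : V) :
    (blockInclusion t *ᵥ f) v = if h : v ∈ t.1 then f ⟨v, h⟩ else 0 := by
  simp only [blockInclusion, Matrix.mulVec, dotProduct, Matrix.of_apply, ite_mul, one_mul,
    zero_mul]
  split_ifs with hv
  · exact (Fintype.sum_eq_single (⟨v, hv⟩ : t.1) fun z hz =>
      if_neg fun h : v = z => hz (Subtype.ext h.symm)).trans (if_pos rfl)
  · exact Finset.sum_eq_zero fun z _ => if_neg fun h : v = z => hv (h ▸ z.2)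

variable [Fintype V]

theorem vecMul_blockInclusion (t : Block G) (g : V → ℝ) :
    g ᵥ* blockInclusion t = fun z : t.1 => g z := by
  ext z
  simp [blockInclusion, Matrix.vecMul, dotProduct]

theorem one_vecMul_blockInclusion (t : Block G) : 1 ᵥ* blockInclusion t = 1 :=
  vecMul_blockInclusion t 1

variable (B : ∀ t : Block G, LapData t.1)

theorem composition_L : (composition G B).L
    = ∑ t, blockInclusion t * (B t).L * (blockInclusion t)ᵀ := by
  refine Finset.sum_congr rfl fun t _ => ?_
  ext u v
  have hrow : (blockInclusion t * (B t).L) u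
      = fun z => if h : u ∈ t.1 then (B t).L ⟨u, h⟩ z else 0 :=
    funext fun z => blockInclusion_mulVec_apply t (fun y => (B t).L y z) u
  rw [Matrix.mul_apply_eq_vecMul, Matrix.vecMul_transpose, blockInclusion_mulVec_apply, hrow,
    Matrix.of_apply]
  by_cases hu : u ∈ t.1 <;> by_cases hv : v ∈ t.1 <;> simp [hu, hv]

variable {B}

omit [DecidableEq V] in
theorem isLaplacianLike_composition (hB : ∀ t, IsLaplacianLike (B t).L) :
    IsLaplacianLike (composition G B).L := by
  classical
  constructor
  · rw [composition_L, Matrix.sum_mulVec]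
    refine Finset.sum_eq_zero fun t _ => ?_
    rw [← Matrix.mulVec_mulVec, Matrix.mulVec_transpose, one_vecMul_blockInclusion,
      ← Matrix.mulVec_mulVec, (hB t).1, Matrix.mulVec_zero]
  · rw [composition_L, Matrix.vecMul_sum]
    refine Finset.sum_eq_zero fun t _ => ?_
    rw [← Matrix.vecMul_vecMul, ← Matrix.vecMul_vecMul, one_vecMul_blockInclusion,
      (hB t).2, Matrix.zero_vecMul]

end BlockInclusion

section Composition

variable {V : Type*} [Fintype V] {G : Digraph V} (hH : G.toSimpleGraphInclusive.Connected)

/-- The vertex of the block `t` through which all walks from `x` enter `t`. -/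
noncomputable def gate (t : Block G) (x : V) : t.1 :=
  ⟨_, (exists_isGate hH (isBlock_iff.1 t.2) x).choose_spec.1⟩

theorem isGate_gate (t : Block G) (x : V) :
    IsGate G.toSimpleGraphInclusive t.1 x (gate hH t x) :=
  (exists_isGate hH (isBlock_iff.1 t.2) x).choose_spec

theorem exists_gate_ne {x y : V} (hxy : x ≠ y) :
    ∃ t : Block G, y ∈ t.1 ∧ (gate hH t x : V) ≠ y := by
  obtain ⟨S, hS, hyS, hne⟩ := exists_isGate_ne hH hxy
  lift S to Finset V using S.toFinite
  exact ⟨⟨S, isBlock_iff.2 hS⟩, hyS, hne _ (isGate_gate hH ⟨S, isBlock_iff.2 hS⟩ x)⟩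

theorem eq_of_gate_ne {s t : Block G} {x y : V} (hs : y ∈ s.1) (ht : y ∈ t.1)
    (hsx : (gate hH s x : V) ≠ y) (htx : (gate hH t x : V) ≠ y) : s = t :=
  Subtype.ext (Finset.coe_injective ((isGate_gate hH s x).eq_of_ne hH (isBlock_iff.1 s.2)
    (isBlock_iff.1 t.2) hs ht (isGate_gate hH t x) hsx htx))

variable [DecidableEq V]

theorem sum_gate_eq (x y : V) :
    ∑ t : Block G, (if (gate hH t x : V) = y then 1 else 0 : ℝ)
      = blockIndex G y - 1 + if x = y then 1 else 0 := by
  have hindex : (blockIndex G y : ℝ) = ∑ t : Block G, if y ∈ t.1 then 1 else 0 := by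
    rw [blockIndex, Nat.card_eq_fintype_card, Fintype.card_subtype, Finset.sum_boole]
  have hsplit (t : Block G) : (if y ∈ t.1 then 1 else 0 : ℝ)
      = (if (gate hH t x : V) = y then 1 else 0)
        + if y ∈ t.1 ∧ (gate hH t x : V) ≠ y then 1 else 0 := by
    have hmem : (gate hH t x : V) = y → y ∈ t.1 := fun h => h ▸ (gate hH t x).2
    by_cases hgate : (gate hH t x : V) = y
    · simp [hgate, hmem hgate]
    · simp [hgate]
  have hne : ∑ t : Block G, (if y ∈ t.1 ∧ (gate hH t x : V) ≠ y then 1 else 0 : ℝ)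
      = if x = y then 0 else 1 := by
    split_ifs with hxy
    · refine Finset.sum_eq_zero fun t _ => if_neg fun h => h.2 ?_
      rw [(isGate_gate hH t x).eq_of_mem (hxy ▸ h.1), hxy]
    · obtain ⟨s, hys, hsx⟩ := exists_gate_ne hH hxy
      exact (Fintype.sum_eq_single s fun t hts => if_neg fun h =>
        hts (eq_of_gate_ne hH h.1 hys h.2 hsx)).trans (if_pos ⟨hys, hsx⟩)
  rw [hindex]
  simp only [hsplit, Finset.sum_add_distrib, hne]
  split_ifs <;> ring

theorem sum_extend_sub_blockIndex (f : ∀ t : Block G, t.1 → ℝ) (x v : V) :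
    (∑ t : Block G, if h : v ∈ t.1 then f t ⟨v, h⟩ else 0) - ((blockIndex G v : ℝ) - 1)
      = (Pi.single x 1 + ∑ t, blockInclusion t *ᵥ (f t - Pi.single (gate hH t x) 1) : V → ℝ) v := by
  have hgate (t : Block G) : (blockInclusion t *ᵥ Pi.single (gate hH t x) 1) v
      = if (gate hH t x : V) = v then 1 else 0 := by
    simp [blockInclusion, eq_comm]
  simp only [Matrix.mulVec_sub, Pi.add_apply, Finset.sum_apply, Pi.sub_apply, hgate,
    blockInclusion_mulVec_apply, Finset.sum_sub_distrib, sum_gate_eq, Pi.single_apply,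
    eq_comm (a := v)]
  ring

variable (B : ∀ t : Block G, LapData t.1)

theorem composition_β (x : V) : (composition G B).β
    = Pi.single x 1 + ∑ t, blockInclusion t *ᵥ ((B t).β - Pi.single (gate hH t x) 1) := by
  ext v
  rw [← sum_extend_sub_blockIndex]
  simp only [composition]
  congr!

theorem composition_α (x : V) : (composition G B).α
    = Pi.single x 1 + ∑ t, blockInclusion t *ᵥ ((B t).α - Pi.single (gate hH t x) 1) := by
  ext v
  rw [← sum_extend_sub_blockIndex]
  simp only [composition]
  congr!

variable {B}

theorem dotProduct_composition_β (x : V) (g : V → ℝ) : g ⬝ᵥ (composition G B).β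
    = g x + ∑ t, (g ᵥ* blockInclusion t) ⬝ᵥ ((B t).β - Pi.single (gate hH t x) 1) := by
  rw [composition_β hH B x, dotProduct_add, dotProduct_sum, dotProduct_single_one]
  simp only [Matrix.dotProduct_mulVec]

omit [DecidableEq V] in
include hH in
theorem sum_composition_β (hB : ∀ t, ∑ z, (B t).β z = 1) : ∑ x, (composition G B).β x = 1 := by
  classical
  obtain ⟨x⟩ := hH.nonempty
  rw [← one_dotProduct, dotProduct_composition_β hH x, Pi.one_apply]
  simp only [one_vecMul_blockInclusion, dotProduct_sub, one_dotProduct, hB, dotProduct_single_one,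
    Pi.one_apply, sub_self, Finset.sum_const_zero, add_zero]

variable {W : V → V → ℝ} (hG : ∀ x y, ∃ l, IsDirectedPath G x y l)
include hG

theorem distMatrix_vecMul_blockInclusion (t : Block G) (x : V) :
    distMatrix G W x ᵥ* blockInclusion t
      = distMatrix G W x (gate hH t x) • 1 + blockDistMatrix G W t (gate hH t x) := by
  rw [vecMul_blockInclusion]
  ext z
  rw [distMatrix_eq_add_of_isGate hG t (isGate_gate hH t x) z.2, Pi.add_apply,
    blockDistMatrix_apply, Pi.smul_apply, Pi.one_apply, smul_eq_mul, mul_one]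

variable (hB : ∀ t, IsLapExpressible (blockDistMatrix G W t) (B t))
include hH hB

theorem distMatrix_mulVec_composition_β :
    distMatrix G W *ᵥ (composition G B).β = (composition G B).lam • 1 := by
  ext x
  have hblock (t : Block G) : (distMatrix G W x ᵥ* blockInclusion t) ⬝ᵥ
      ((B t).β - Pi.single (gate hH t x) 1) = (B t).lam := by
    have hgate : blockDistMatrix G W t (gate hH t x) ⬝ᵥ (B t).β = (B t).lam :=
      (congrFun (hB t).mulVec_β (gate hH t x)).trans (mul_one _)
    rw [distMatrix_vecMul_blockInclusion hH hG, add_dotProduct, smul_dotProduct,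
      dotProduct_sub, dotProduct_sub, one_dotProduct, (hB t).sum_β, hgate, dotProduct_single_one,
      dotProduct_single_one, Pi.one_apply, sub_self, smul_zero, zero_add, blockDistMatrix,
      distMatrix_self, sub_zero]
  change distMatrix G W x ⬝ᵥ (composition G B).β = _
  rw [dotProduct_composition_β hH x, distMatrix_self, zero_add, Pi.smul_apply, Pi.one_apply,
    smul_eq_mul, mul_one]
  exact Finset.sum_congr rfl fun t _ => hblock t

theorem distMatrix_mul_composition_L :
    distMatrix G W * (composition G B).L = Matrix.vecMulVec 1 (composition G B).α - 1 := by
  refine funext fun x => ?_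
  have hblock (t : Block G) : (distMatrix G W x ᵥ* blockInclusion t) ᵥ* (B t).L
      = (B t).α - Pi.single (gate hH t x) 1 := by
    have hgate : blockDistMatrix G W t (gate hH t x) ᵥ* (B t).L
        = (B t).α - Pi.single (gate hH t x) 1 := by
      rw [← Matrix.mul_apply_eq_vecMul, (hB t).mul_L]
      ext z
      simp [Matrix.one_apply, Pi.single_apply, eq_comm]
    rw [distMatrix_vecMul_blockInclusion hH hG, Matrix.add_vecMul, Matrix.smul_vecMul,
      (hB t).isLaplacianLike.2, smul_zero, zero_add, hgate]
  rw [Matrix.mul_apply_eq_vecMul, composition_L, Matrix.vecMul_sum]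
  simp only [← Matrix.vecMul_vecMul, hblock, Matrix.vecMul_transpose]
  rw [eq_sub_of_add_eq' (composition_α hH B x).symm]
  ext z
  simp [Matrix.one_apply, Pi.single_apply, eq_comm]

theorem isLapExpressible_composition : IsLapExpressible (distMatrix G W) (composition G B) where
  sum_β := sum_composition_β hH fun t => (hB t).sum_β
  mulVec_β := distMatrix_mulVec_composition_β hH hG hB
  mul_L := distMatrix_mul_composition_L hH hG hB
  isLaplacianLike := isLaplacianLike_composition fun t => (hB t).isLaplacianLike

end Composition

end CactoidType

theorem mainTheorem5_general {V : Type*} [Fintype V] [DecidableEq V] (G : Digraph V)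
    (hG : CactoidType.IsCactoidType G) (W : V → V → ℝ)
    (hD : (CactoidType.distMatrix G W).det ≠ 0)
    (hcof : ∀ t : CactoidType.Block G,
      CactoidType.cof (CactoidType.blockDistMatrix G W t) ≠ 0) :
    (∀ t : CactoidType.Block G,
      ∃ P : CactoidType.DCPresentation (CactoidType.induce G t.1),
        P.IsOrdered (fun x y => W x y)) ∧
    ∀ P : (t : CactoidType.Block G) → CactoidType.DCPresentation (CactoidType.induce G t.1),
      (∀ t, (P t).IsOrdered (fun x y => W x y)) →
      ∃ (𝓛 : Matrix V V ℝ) (α β : V → ℝ) (lam : ℝ),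
        CactoidType.composition G (fun t => (P t).lapData (fun x y => W x y))
          = ⟨lam, α, β, 𝓛⟩ ∧
        (∀ t, ((P t).lapData (fun x y => W x y)).lam =
          (CactoidType.blockDistMatrix G W t).det /
            CactoidType.cof (CactoidType.blockDistMatrix G W t)) ∧
        CactoidType.IsLaplacianLike 𝓛 ∧
        lam ≠ 0 ∧
        (CactoidType.distMatrix G W)⁻¹ = -𝓛 + (1 / lam) • Matrix.vecMulVec β α := by
  have hpath (x y : V) := CactoidType.exists_isDirectedPath (hG.1.2 x y)
  have := hG.1.1
  have hconn := CactoidType.connected_of_exists_isDirectedPath hpath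
  refine ⟨fun t => (hG.2 t).elim fun P => P.exists_isOrdered _, fun P hP => ?_⟩
  have hblock (t : CactoidType.Block G) : CactoidType.IsLapExpressible
      (CactoidType.blockDistMatrix G W t) ((P t).lapData fun x y => W x y) :=
    (P t).isLapExpressible _ (CactoidType.exists_isDirectedPath_induce hpath t) (hcof t) (hP t)
  have h := CactoidType.isLapExpressible_composition hconn hpath hblock
  exact ⟨_, _, _, _, rfl, fun t => eq_div_of_mul_eq (hcof t) (hblock t).det_eq.symm,
    h.isLaplacianLike, h.lam_ne_zero hD, h.inv_eq hD⟩

theorem mainTheorem5 {V : Type*} [Fintype V] [DecidableEq V] (G : Digraph V)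
    (hG : CactoidType.IsCactoidType G) (W : V → V → ℝ)
    (hD : (CactoidType.distMatrix G W).det ≠ 0)
    (hDt : ∀ t : CactoidType.Block G, (CactoidType.blockDistMatrix G W t).det ≠ 0)
    (hcof : ∀ t : CactoidType.Block G,
      CactoidType.cof (CactoidType.blockDistMatrix G W t) ≠ 0) :
    (∀ t : CactoidType.Block G,
      ∃ P : CactoidType.DCPresentation (CactoidType.induce G t.1),
        P.IsOrdered (fun x y => W x y)) ∧
    ∀ P : (t : CactoidType.Block G) → CactoidType.DCPresentation (CactoidType.induce G t.1),
      (∀ t, (P t).IsOrdered (fun x y => W x y)) →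
      ∃ (𝓛 : Matrix V V ℝ) (α β : V → ℝ) (lam : ℝ),
        CactoidType.composition G (fun t => (P t).lapData (fun x y => W x y))
          = ⟨lam, α, β, 𝓛⟩ ∧
        (∀ t, ((P t).lapData (fun x y => W x y)).lam =
          (CactoidType.blockDistMatrix G W t).det /
            CactoidType.cof (CactoidType.blockDistMatrix G W t)) ∧
        CactoidType.IsLaplacianLike 𝓛 ∧
        lam ≠ 0 ∧
        (CactoidType.distMatrix G W)⁻¹ = -𝓛 + (1 / lam) • Matrix.vecMulVec β α :=
  mainTheorem5_general G hG W hD hcof
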